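/- Let $n\ge 1$, let $q\neq 0$ be real, let $\phi\in\mathbb R$, and let $p:\{1,\dots,n\}\to\mathbb Z$ satisfy $\sum_{k=1}^n p(k)=0$. Let $\mathcal A=\mathcal A(SU_q(n))$ be the unital complex algebra generated by $u_{ij}$, $1\le i,j\le n$, with the relations $u_{ik}u_{jk}=q\,u_{jk}u_{ik}$ and $u_{ki}u_{kj}=q\,u_{kj}u_{ki}$ for $i<j$; $u_{il}u_{jk}=u_{jk}u_{il}$ and $u_{ik}u_{jl}-u_{jl}u_{ik}=(q-q^{-1})u_{jk}u_{il}$ for $i<j$, $k<l$; and $\sum_{\sigma\in S_n}(-q)^{|\sigma|}u_{1\sigma(1)}\cdots u_{n\sigma(n)}=1$, where $|\sigma|$ is the number of inversions. It carries a Hopf $*$-algebra structure with $\Delta(u_{ij})=\sum_k u_{ik}\otimes u_{kj}$, $\epsilon(u_{ij})=\delta_{ij}$, $S(u_{ij})=(u_{ji})^*$ and $(u_{ij})^*=(-q)^{j-i}\sum_\sigma(-q)^{|\sigma|}u_{k_1\sigma(l_1)}\cdots u_{k_{n-1}\sigma(l_{n-1})}$, where $k_1<\dots<k_{n-1}$ are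 the indices different from $i$, $l_1<\dots<l_{n-1}$ those different from $j$, and $\sigma$ runs over the permutations of the $l$'s. Then $\alpha:u_{ij}\mapsto z^{p(i)}\delta_{ij}$ defines a morphism of Hopf $*$-algebras $\alpha:\mathcal A\to\mathbb C[z,z^{-1}]$ (where $\Delta z=z\otimes z$ and $z^*=z^{-1}$). Call $x\in\mathcal A$ homogeneous of degrees $\mu(x),\nu(x)\in\mathbb Z$ if $(\alpha\otimes\mathrm{id})\Delta(x)=z^{\mu(x)}\otimes x$ and $(\mathrm{id}\otimes\alpha)\Delta(x)=x\otimes z^{\nu(x)}$, and put $\delta(x)=\mu(x)-\nu(x)$. Then $\mathcal A$ has a countable basis of homogeneous elements, and $u_{ij}$ is homogeneous with $\mu(u_{ij})=p(i)$, $\nu(u_{ij})=p(j)$. Let $\mathcal A_\phi(SU_q(n))$ be the vector space $\mathcal A$ with the same unit and counit and with the linear maps given for homogeneous $x,y$ by $$x*y=e^{i\phi(\mu(x)\nu(y)-\nu(x)\mu(y))}\,xy,\qquad \Delta_\phi(x)=\sum_r e^{i\phi\,\delta(x^r_{(1)})\delta(x^r_{(2)})}\,x^r_{(1)}\otimes x^r_{(2)},$$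 $$\Psi(x\otimes y)=e^{2i\phi\,\delta(x)\delta(y)}\,y\otimes x,\qquad S_\phi(x)=e^{i\phi\,\delta(x)^2}S(x),$$ where $\Delta(x)=\sum_r x^r_{(1)}\otimes x^r_{(2)}$ with all $x^r_{(1)},x^r_{(2)}$ homogeneous. Then $\mathcal A_\phi(SU_q(n))$ is a braided Hopf algebra with braiding $\Psi$: $\Psi$ is an invertible solution of the braid equation; $(*,1)$ is an associative unital algebra and $(\Delta_\phi,\epsilon)$ a coassociative counital coalgebra; product, unit, coproduct, counit and antipode commute with $\Psi$; $\Delta_\phi$ and $\epsilon$ are unital algebra maps, where $\mathcal A\otimes\mathcal A$ has the product $(a\otimes b)*(c\otimes d)=a*\Psi(b\otimes c)*d$; and, with $m_*(x\otimes y)=x*y$, $m_*(S_\phi\otimes\mathrm{id})\Delta_\phi=\epsilon(\cdot)1=m_*(\mathrm{id}\otimes S_\phi)\Delta_\phi$. On the generators, $$u_{ij}*u_{kl}=e^{i\phi(p(i)p(l)-p(k)p(j))}u_{ij}u_{kl},\qquad \Delta_\phi(u_{ij})=\sum_k e^{i\phi(p(i)-p(k))(p(k)-p(j))}u_{ik}\otimes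 u_{kj},$$ $$\Psi(u_{ij}\otimes u_{kl})=e^{2i\phi(p(i)-p(j))(p(k)-p(l))}u_{kl}\otimes u_{ij},\qquad S_\phi(u_{ij})=e^{i\phi(p(i)-p(j))^2}S(u_{ij}).$$ -/

import Mathlib

open scoped TensorProduct LaurentPolynomial BigOperators ComplexConjugate

noncomputable section

/-! ### The algebra `A(SU_q(n))` by generators and relations -/

namespace SUq

/-- The number of inversions `|σ|` of a permutation. -/
def inversions {n : ℕ} (σ : Equiv.Perm (Fin n)) : ℕ :=
  (Finset.univ.filter fun a : Fin n × Fin n => a.1 < a.2 ∧ σ a.2 < σ a.1).card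

/-- The free complex algebra on symbols `u i j`. -/
abbrev Free (n : ℕ) : Type := FreeAlgebra ℂ (Fin n × Fin n)

/-- The free generator with row index `i` and column index `j`. -/
def gen {n : ℕ} (i j : Fin n) : Free n := FreeAlgebra.ι ℂ (i, j)

/-- The quantum determinant `∑ σ, (-q)^|σ| u_{1 σ(1)} ⋯ u_{n σ(n)}`. -/
def qdet (n : ℕ) (q : ℝ) : Free n :=
  ∑ σ : Equiv.Perm (Fin n),
    (-(q : ℂ)) ^ inversions σ • (List.ofFn fun k : Fin n => gen k (σ k)).prod

/-- The element `(-q)^(j-i) ∑ σ, (-q)^|σ| u_{k₁ σ(l₁)} ⋯ u_{kₙ₋₁ σ(lₙ₋₁)}`, where `k` and `l` list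
in increasing order the indices different from `i` and from `j`. -/
def cofactor (q : ℝ) : {n : ℕ} → Fin n → Fin n → Free n
  | 0, i, _ => i.elim0
  | m + 1, i, j =>
    (-(q : ℂ)) ^ ((j : ℤ) - (i : ℤ)) • ∑ σ : Equiv.Perm (Fin m),
      (-(q : ℂ)) ^ inversions σ •
        (List.ofFn fun k : Fin m => gen (i.succAbove k) (j.succAbove (σ k))).prod

/-- The defining relations of `A(SU_q(n))`. -/
inductive Rel (n : ℕ) (q : ℝ) : Free n → Free n → Prop
  | col (i j k : Fin n) (hij : i < j) :
      Rel n q (gen i k * gen j k) ((q : ℂ) • (gen j k * gen i k))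
  | row (i j k : Fin n) (hij : i < j) :
      Rel n q (gen k i * gen k j) ((q : ℂ) • (gen k j * gen k i))
  | comm (i j k l : Fin n) (hij : i < j) (hkl : k < l) :
      Rel n q (gen i l * gen j k) (gen j k * gen i l)
  | cross (i j k l : Fin n) (hij : i < j) (hkl : k < l) :
      Rel n q (gen i k * gen j l - gen j l * gen i k)
        (((q : ℂ) - (q : ℂ)⁻¹) • (gen j k * gen i l))
  | det : Rel n q (qdet n q) 1

end SUq

/-- The algebra `A(SU_q(n))`. -/
def SUq (n : ℕ) (q : ℝ) : Type := RingQuot (SUq.Rel n q)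

namespace SUq

instance instRing (n : ℕ) (q : ℝ) : Ring (SUq n q) :=
  inferInstanceAs (Ring (RingQuot (SUq.Rel n q)))

/-- The quotient map from the free algebra. -/
def mk (n : ℕ) (q : ℝ) : Free n →+* SUq n q := RingQuot.mkRingHom (Rel n q)

/-- The generator `u_{ij}` of `A(SU_q(n))`. -/
def u (n : ℕ) (q : ℝ) (i j : Fin n) : SUq n q := mk n q (gen i j)

/-- The given Hopf algebra structure and the given involution on the ring `A(SU_q(n))` form its
standard Hopf `∗`-algebra structure. As the `u_{ij}` generate the algebra, there is at most one
such structure. -/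
structure IsStandardHopfStar (n : ℕ) (q : ℝ) [HopfAlgebra ℂ (SUq n q)] [StarRing (SUq n q)]
    [StarModule ℂ (SUq n q)] : Prop where
  /-- Complex scalars are those of the quotient algebra. -/
  algebraMap_eq : ∀ c : ℂ, algebraMap ℂ (SUq n q) c = mk n q (algebraMap ℂ (Free n) c)
  comul_u : ∀ i j, Coalgebra.comul (R := ℂ) (u n q i j) = ∑ k, u n q i k ⊗ₜ[ℂ] u n q k j
  counit_u : ∀ i j, Coalgebra.counit (R := ℂ) (u n q i j) = if i = j then 1 else 0
  antipode_u : ∀ i j, HopfAlgebra.antipode ℂ (u n q i j) = star (u n q j i)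
  star_u : ∀ i j, star (u n q i j) = mk n q (cofactor q i j)
  comul_star : ∀ x : SUq n q, Coalgebra.comul (R := ℂ) (star x) = star (Coalgebra.comul (R := ℂ) x)
  counit_star : ∀ x : SUq n q,
    Coalgebra.counit (R := ℂ) (star x) = conj (Coalgebra.counit (R := ℂ) x)

end SUq

/-! ### Braided Hopf algebras -/

namespace BraidedHopf

variable {V : Type*} [AddCommGroup V] [Module ℂ V]

/-- `Ψ ⊗ id` on `V ⊗ V ⊗ V`. -/
def on12 (Ψ : V ⊗[ℂ] V →ₗ[ℂ] V ⊗[ℂ] V) : V ⊗[ℂ] (V ⊗[ℂ] V) →ₗ[ℂ] V ⊗[ℂ] (V ⊗[ℂ] V) :=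
  (TensorProduct.assoc ℂ V V V).toLinearMap ∘ₗ Ψ.rTensor V ∘ₗ
    (TensorProduct.assoc ℂ V V V).symm.toLinearMap

/-- `id ⊗ Ψ` on `V ⊗ V ⊗ V`. -/
def on23 (Ψ : V ⊗[ℂ] V →ₗ[ℂ] V ⊗[ℂ] V) : V ⊗[ℂ] (V ⊗[ℂ] V) →ₗ[ℂ] V ⊗[ℂ] (V ⊗[ℂ] V) :=
  Ψ.lTensor V

/-- `id ⊗ Ψ ⊗ id` on `(V ⊗ V) ⊗ (V ⊗ V)`. -/
def onMiddle (Ψ : V ⊗[ℂ] V →ₗ[ℂ] V ⊗[ℂ] V) :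
    (V ⊗[ℂ] V) ⊗[ℂ] (V ⊗[ℂ] V) →ₗ[ℂ] (V ⊗[ℂ] V) ⊗[ℂ] (V ⊗[ℂ] V) :=
  (TensorProduct.assoc ℂ V V (V ⊗[ℂ] V)).symm.toLinearMap ∘ₗ
    (on12 Ψ).lTensor V ∘ₗ
    (TensorProduct.assoc ℂ V V (V ⊗[ℂ] V)).toLinearMap

end BraidedHopf

open BraidedHopf in
/-- A braided Hopf algebra: an algebra `(V, m, e)` and a coalgebra `(V, Δ, ε)` with an invertible
braiding `Ψ` on `V ⊗ V` for which all structure maps are morphisms (they commute with `Ψ`), such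
that `Δ` and `ε` are algebra maps for the braided product
`(a ⊗ b)(c ⊗ d) = a Ψ(b ⊗ c) d` on `V ⊗ V`, and with an antipode `S`. -/
structure IsBraidedHopfAlgebra {V : Type*} [AddCommGroup V] [Module ℂ V]
    (m : V ⊗[ℂ] V →ₗ[ℂ] V) (e : V) (Δ : V →ₗ[ℂ] V ⊗[ℂ] V) (ε : V →ₗ[ℂ] ℂ) (S : V →ₗ[ℂ] V)
    (Ψ : V ⊗[ℂ] V →ₗ[ℂ] V ⊗[ℂ] V) : Prop where
  -- associative unital algebra
  mul_assoc : ∀ x y z, m (m (x ⊗ₜ y) ⊗ₜ z) = m (x ⊗ₜ m (y ⊗ₜ z))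
  one_mul : ∀ x, m (e ⊗ₜ x) = x
  mul_one : ∀ x, m (x ⊗ₜ e) = x
  -- coassociative counital coalgebra
  coassoc : (TensorProduct.assoc ℂ V V V).toLinearMap ∘ₗ Δ.rTensor V ∘ₗ Δ = Δ.lTensor V ∘ₗ Δ
  counit_comul : ∀ x, TensorProduct.lid ℂ V (ε.rTensor V (Δ x)) = x
  comul_counit : ∀ x, TensorProduct.rid ℂ V (ε.lTensor V (Δ x)) = x
  -- invertible solution of the braid equation
  braiding_bijective : Function.Bijective Ψ
  braid_equation : on23 Ψ ∘ₗ on12 Ψ ∘ₗ on23 Ψ = on12 Ψ ∘ₗ on23 Ψ ∘ₗ on12 Ψ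
  -- the structure maps commute with the braiding
  braiding_one_left : ∀ x, Ψ (e ⊗ₜ x) = x ⊗ₜ e
  braiding_one_right : ∀ x, Ψ (x ⊗ₜ e) = e ⊗ₜ x
  braiding_mul_right : Ψ ∘ₗ m.lTensor V =
    m.rTensor V ∘ₗ (TensorProduct.assoc ℂ V V V).symm.toLinearMap ∘ₗ on23 Ψ ∘ₗ on12 Ψ
  braiding_mul_left : Ψ ∘ₗ m.rTensor V ∘ₗ (TensorProduct.assoc ℂ V V V).symm.toLinearMap =
    m.lTensor V ∘ₗ on12 Ψ ∘ₗ on23 Ψ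
  braiding_comul_left : Δ.lTensor V ∘ₗ Ψ =
    on12 Ψ ∘ₗ on23 Ψ ∘ₗ (TensorProduct.assoc ℂ V V V).toLinearMap ∘ₗ Δ.rTensor V
  braiding_comul_right : (TensorProduct.assoc ℂ V V V).toLinearMap ∘ₗ Δ.rTensor V ∘ₗ Ψ =
    on23 Ψ ∘ₗ on12 Ψ ∘ₗ Δ.lTensor V
  braiding_counit_left : ∀ x y, TensorProduct.rid ℂ V (ε.lTensor V (Ψ (x ⊗ₜ y))) = ε x • y
  braiding_counit_right : ∀ x y, TensorProduct.lid ℂ V (ε.rTensor V (Ψ (x ⊗ₜ y))) = ε y • x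
  braiding_antipode_left : Ψ ∘ₗ S.rTensor V = S.lTensor V ∘ₗ Ψ
  braiding_antipode_right : Ψ ∘ₗ S.lTensor V = S.rTensor V ∘ₗ Ψ
  -- `Δ` and `ε` are algebra maps
  comul_one : Δ e = e ⊗ₜ e
  comul_mul : Δ ∘ₗ m = TensorProduct.map m m ∘ₗ onMiddle Ψ ∘ₗ TensorProduct.map Δ Δ
  counit_one : ε e = 1
  counit_mul : ∀ x y, ε (m (x ⊗ₜ y)) = ε x * ε y
  -- the antipode is the convolution inverse of the identity
  antipode_left : ∀ x, m (S.rTensor V (Δ x)) = ε x • e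
  antipode_right : ∀ x, m (S.lTensor V (Δ x)) = ε x • e

/-! ### Twisting a Hopf algebra along a Hopf algebra map to `ℂ[z, z⁻¹]` -/

namespace HopfTwist

/-- The involution on `ℂ[z, z⁻¹]`: conjugate-linear with `z ↦ z⁻¹`. -/
def laurentStar (f : ℂ[T;T⁻¹]) : ℂ[T;T⁻¹] :=
  f.coeff.sum fun k c => LaurentPolynomial.C (conj c) * LaurentPolynomial.T (-k)

/-- The linear map `ℂ[z, z⁻¹] ⊗ M → N` with `z ^ k ⊗ x ↦ w k x`. -/
def laurentLift {M N : Type*} [AddCommGroup M] [Module ℂ M] [AddCommGroup N] [Module ℂ N]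
    (w : ℤ → M →ₗ[ℂ] N) : ℂ[T;T⁻¹] ⊗[ℂ] M →ₗ[ℂ] N :=
  TensorProduct.lift
    (Finsupp.linearCombination ℂ w ∘ₗ (AddMonoidAlgebra.coeffLinearEquiv ℂ).toLinearMap)

theorem laurentLift_T {M N : Type*} [AddCommGroup M] [Module ℂ M] [AddCommGroup N] [Module ℂ N]
    (w : ℤ → M →ₗ[ℂ] N) (k : ℤ) (x : M) :
    laurentLift w (LaurentPolynomial.T k ⊗ₜ[ℂ] x) = w k x := by
  have h : AddMonoidAlgebra.coeff (LaurentPolynomial.T k : ℂ[T;T⁻¹]) = Finsupp.single k 1 := rfl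
  simp [laurentLift, h]

variable {H : Type*} [Ring H] [HopfAlgebra ℂ H] (α : H →ₐc[ℂ] ℂ[T;T⁻¹])

/-- The left coaction `Δ_L = (α ⊗ id) Δ`. -/
def leftCoaction : H →ₗ[ℂ] ℂ[T;T⁻¹] ⊗[ℂ] H :=
  LinearMap.rTensor H (α : H →ₗ[ℂ] ℂ[T;T⁻¹]) ∘ₗ Coalgebra.comul

/-- The right coaction `Δ_R = (id ⊗ α) Δ`. -/
def rightCoaction : H →ₗ[ℂ] H ⊗[ℂ] ℂ[T;T⁻¹] :=
  LinearMap.lTensor H (α : H →ₗ[ℂ] ℂ[T;T⁻¹]) ∘ₗ Coalgebra.comul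

/-- `x` is homogeneous of degrees `μ(x) = μ` and `ν(x) = ν`. -/
def IsHomogeneous (μ ν : ℤ) (x : H) : Prop :=
  leftCoaction α x = LaurentPolynomial.T μ ⊗ₜ[ℂ] x ∧
    rightCoaction α x = x ⊗ₜ[ℂ] LaurentPolynomial.T ν

/-- The linear map which is `x ↦ w μ ν x` on elements homogeneous of degrees `μ, ν`. -/
def bigradedMap {N : Type*} [AddCommGroup N] [Module ℂ N] (w : ℤ → ℤ → H →ₗ[ℂ] N) : H →ₗ[ℂ] N :=
  laurentLift (fun μ => laurentLift (fun ν => w μ ν) ∘ₗ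
    (TensorProduct.comm ℂ H ℂ[T;T⁻¹]).toLinearMap ∘ₗ rightCoaction α) ∘ₗ leftCoaction α

theorem bigradedMap_apply {N : Type*} [AddCommGroup N] [Module ℂ N] (w : ℤ → ℤ → H →ₗ[ℂ] N)
    {μ ν : ℤ} {x : H} (hx : IsHomogeneous α μ ν x) : bigradedMap α w x = w μ ν x := by
  simp [bigradedMap, hx.1, hx.2, laurentLift_T]

/-- The endomorphism of `H ⊗ H` which multiplies `x ⊗ y`, for homogeneous `x` and `y`, by the
scalar `c (μ(x)) (ν(x)) (μ(y)) (ν(y))`. -/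
def scaleTensor (c : ℤ → ℤ → ℤ → ℤ → ℂ) : H ⊗[ℂ] H →ₗ[ℂ] H ⊗[ℂ] H :=
  TensorProduct.lift (bigradedMap α fun μ ν =>
    (bigradedMap α fun μ' ν' => c μ ν μ' ν' • (TensorProduct.mk ℂ H H).flip).flip)

theorem scaleTensor_tmul (c : ℤ → ℤ → ℤ → ℤ → ℂ) {μ ν μ' ν' : ℤ} {x y : H}
    (hx : IsHomogeneous α μ ν x) (hy : IsHomogeneous α μ' ν' y) :
    scaleTensor α c (x ⊗ₜ y) = c μ ν μ' ν' • (x ⊗ₜ[ℂ] y) := by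
  simp [scaleTensor, bigradedMap_apply α _ hx, bigradedMap_apply α _ hy]

/-- The phase `e^{i t}`. -/
def phase (t : ℝ) : ℂ := Complex.exp (Complex.I * t)

/-- The twisted product: `x ∗ y = e^{iφ(μ(x)ν(y) - ν(x)μ(y))} x y` on homogeneous elements. -/
def twistMul (φ : ℝ) : H ⊗[ℂ] H →ₗ[ℂ] H :=
  LinearMap.mul' ℂ H ∘ₗ scaleTensor α fun μ ν μ' ν' => phase (φ * (μ * ν' - ν * μ'))

/-- The twisted coproduct: every term `x₁ ⊗ x₂` of `Δ x` with `x₁`, `x₂` homogeneous is multiplied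
by `e^{iφ δ(x₁) δ(x₂)}`, where `δ = μ - ν`. -/
def twistComul (φ : ℝ) : H →ₗ[ℂ] H ⊗[ℂ] H :=
  (scaleTensor α fun μ ν μ' ν' => phase (φ * ((μ - ν) * (μ' - ν')))) ∘ₗ Coalgebra.comul

/-- The braiding: `Ψ (x ⊗ y) = e^{2iφ δ(x) δ(y)} y ⊗ x` on homogeneous elements. -/
def twistBraiding (φ : ℝ) : H ⊗[ℂ] H →ₗ[ℂ] H ⊗[ℂ] H :=
  (TensorProduct.comm ℂ H H).toLinearMap ∘ₗ
    scaleTensor α fun μ ν μ' ν' => phase (2 * φ * ((μ - ν) * (μ' - ν')))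

/-- The twisted antipode: `S_φ x = e^{iφ δ(x)²} S x` on homogeneous elements. -/
def twistAntipode (φ : ℝ) : H →ₗ[ℂ] H :=
  bigradedMap α fun μ ν => phase (φ * (μ - ν) ^ 2) • HopfAlgebra.antipode ℂ

end HopfTwist

end

/-!
Both parts of the proof reduce to generators or to homogeneous elements.

**The Hopf `∗`-algebra.** Call a matrix over an algebra a quantum matrix (`IsQMatrix`) if its
entries satisfy the quadratic relations of `A(SU_q(n))`. These relations say that the matrix with
entries `u i k * u j l` commutes with the standard solution of the braid equation
(`isQMatrix_iff_commute`). Hence a product of quantum matrices with commuting entries is a quantum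
matrix, which gives the coproduct, and the inverse of a quantum matrix is one over the opposite
algebra, which gives the antipode. The relation `det = 1` is handled by the antisymmetry of the
quantum determinant under permutations of the rows (`det_comp`): it makes the determinant
multiplicative (`det_mul`), it shows that the vector of quantum signs is fixed by the `n`-th tensor
power of the matrix and therefore by that of its inverse (`det_op_inv`), and together with the
Laplace expansions it shows that the matrix of cofactors is inverse to `u` (`sum_mul_cof`,
`sum_cof_mul`). One of these two identities needs the invariance of the determinant under
transposition (`det_transpose`), whose proof uses that `q` is real. The involution is the antipode
composed with the conjugate-linear automorphism `u i j ↦ u j i`. That its square is the identity and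
that it respects the coproduct follow from the uniqueness of inverse matrices.

**The twist.** For a Hopf algebra with a bialgebra map to `ℂ[z, z⁻¹]`, let subspaces `G μ ν` of
homogeneous elements span the algebra and be compatible with the Hopf algebra structure
(`IsBigrading`); here they are spanned by monomials in the generators. The coproduct of an element
of `G μ ν` is a sum of terms `a ⊗ b` with `a ∈ G μ κ` and `b ∈ G κ ν`. On such terms every structure
map of the twist is the original one times a phase, so that each axiom of a braided Hopf algebra
becomes the corresponding axiom of the Hopf algebra together with an identity between exponents,
which are quadratic polynomials in the degrees. Where the counit occurs, the identity holds
because the counit vanishes on `G μ ν` unless `μ = ν` (`IsHomogeneous.eq_or_counit_eq_zero`).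
-/


noncomputable section

/-! ### Quantum matrices and quantum determinants -/

namespace QMatrix

/-- The number of inversions of a map between linearly ordered index sets. -/
def inv {m : ℕ} {ι : Type*} [LinearOrder ι] (f : Fin m → ι) : ℕ :=
  (Finset.univ.filter fun a : Fin m × Fin m => a.1 < a.2 ∧ f a.2 < f a.1).card

theorem swap_lt_swap {m : ℕ} (k : Fin m) {a b : Fin (m + 1)} (hab : a < b)
    (h : ¬ (a = k.castSucc ∧ b = k.succ)) :
    Equiv.swap k.castSucc k.succ a < Equiv.swap k.castSucc k.succ b := by
  rw [Fin.lt_def] at hab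
  simp only [Fin.ext_iff, Fin.val_castSucc, Fin.val_succ] at h
  rw [Fin.lt_def, Equiv.swap_apply_def, Equiv.swap_apply_def]
  split_ifs <;> simp only [Fin.ext_iff, Fin.val_castSucc, Fin.val_succ] at * <;> omega

theorem inv_comp_swap {m : ℕ} {ι : Type*} [LinearOrder ι] (f : Fin (m + 1) → ι) (k : Fin m)
    (h : f k.castSucc < f k.succ) :
    inv (f ∘ Equiv.swap k.castSucc k.succ) = inv f + 1 := by
  have hk : k.castSucc < k.succ := Fin.castSucc_lt_succ
  set I := Finset.univ.filter fun a : Fin (m + 1) × Fin (m + 1) => a.1 < a.2 ∧ f a.2 < f a.1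
    with hI
  let e := Equiv.prodCongr (Equiv.swap k.castSucc k.succ) (Equiv.swap k.castSucc k.succ)
  have hmem : (k.castSucc, k.succ) ∉ I.image e := by
    simp only [hI, e, Finset.mem_image, Finset.mem_filter, Finset.mem_univ, true_and, Prod.exists,
      Equiv.prodCongr_apply, Prod.map, Prod.mk.injEq, not_exists, not_and]
    rintro a b ⟨hab, -⟩ h1 h2
    rw [Equiv.swap_apply_eq_iff] at h1 h2
    simp only [Equiv.swap_apply_left, Equiv.swap_apply_right] at h1 h2
    subst h1 h2
    exact lt_asymm hk hab
  have hins : (Finset.univ.filter fun a : Fin (m + 1) × Fin (m + 1) => a.1 < a.2 ∧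
      (f ∘ Equiv.swap k.castSucc k.succ) a.2 < (f ∘ Equiv.swap k.castSucc k.succ) a.1) =
      insert (k.castSucc, k.succ) (I.image e) := by
    ext ⟨a, b⟩
    simp only [hI, e, Finset.mem_filter, Finset.mem_univ, true_and, Function.comp,
      Finset.mem_insert, Finset.mem_image, Prod.mk.injEq, Prod.exists, Equiv.prodCongr_apply,
      Prod.map]
    constructor
    · rintro ⟨hab, hf⟩
      by_cases h' : a = k.castSucc ∧ b = k.succ
      · exact Or.inl h'
      · exact Or.inr ⟨_, _, ⟨swap_lt_swap k hab h', hf⟩, by simp, by simp⟩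
    · rintro (⟨rfl, rfl⟩ | ⟨a, b, ⟨hab, hf⟩, rfl, rfl⟩)
      · exact ⟨hk, by simpa using h⟩
      · refine ⟨swap_lt_swap k hab ?_, by simpa using hf⟩
        rintro ⟨rfl, rfl⟩
        exact lt_asymm h hf
  rw [inv, hins, Finset.card_insert_of_notMem hmem, Finset.card_image_of_injective _ e.injective,
    hI, inv]

/-- In a product over `Fin (m + 1)`, the two factors in positions `k` and `k + 1` can be isolated,
and the remaining factors depend on the other entries only. -/
theorem exists_prod_ofFn_eq {A : Type*} [Monoid A] : ∀ {m : ℕ} (k : Fin m) (g : Fin (m + 1) → A),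
    ∃ L R : A, ∀ h : Fin (m + 1) → A, (∀ a, a ≠ k.castSucc → a ≠ k.succ → h a = g a) →
      (List.ofFn h).prod = L * (h k.castSucc * h k.succ) * R
  | 0, k, _ => k.elim0
  | m + 1, k, g => by
    induction k using Fin.cases with
    | zero =>
      refine ⟨1, (List.ofFn fun a : Fin m => g a.succ.succ).prod, fun h hh => ?_⟩
      have : (fun a : Fin m => h a.succ.succ) = fun a => g a.succ.succ := by
        funext a
        exact hh _ (by simp [Fin.ext_iff]) (by simp [Fin.ext_iff])
      simp [List.ofFn_succ, this, mul_assoc]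
    | succ k =>
      obtain ⟨L, R, H⟩ := exists_prod_ofFn_eq k fun a => g a.succ
      refine ⟨g 0 * L, R, fun h hh => ?_⟩
      rw [List.ofFn_succ, List.prod_cons, H (fun a => h a.succ), hh 0]
      · simp only [mul_assoc, Fin.succ_castSucc]
      · simp [Fin.ext_iff]
      · simp [Fin.ext_iff]
      · intro a h1 h2
        apply hh
        · rw [← Fin.succ_castSucc]
          simpa using h1
        · simpa using h2

/-- The quadratic relations of `A(SU_q(n))` for the entries of `u`. Rows and columns may be indexed
by any linear orders, so that submatrices are included. -/
structure _root_.IsQMatrix (q : ℂ) {ι κ A : Type*} [LinearOrder ι] [LinearOrder κ] [Ring A]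
    [Algebra ℂ A] (u : ι → κ → A) : Prop where
  col : ∀ i j k, i < j → u i k * u j k = q • (u j k * u i k)
  row : ∀ i j k, i < j → u k i * u k j = q • (u k j * u k i)
  comm : ∀ i j k l, i < j → k < l → u i l * u j k = u j k * u i l
  cross : ∀ i j k l, i < j → k < l →
    u i k * u j l - u j l * u i k = (q - q⁻¹) • (u j k * u i l)

/-- The quantum determinant of a square matrix, with the factors of each term ordered by rows. -/
def det (q : ℂ) {m : ℕ} {A : Type*} [Ring A] [Algebra ℂ A] (w : Fin m → Fin m → A) : A :=
  ∑ σ : Equiv.Perm (Fin m), (-q) ^ inv σ • (List.ofFn fun k => w k (σ k)).prod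

variable {q : ℂ} {A : Type*} [Ring A] [Algebra ℂ A]

theorem map_det {B : Type*} [Ring B] [Algebra ℂ B] (φ : A →ₐ[ℂ] B) {m : ℕ}
    (w : Fin m → Fin m → A) : φ (det q w) = det q fun i j => φ (w i j) := by
  simp only [det, map_sum, map_smul, map_list_prod, List.map_ofFn]
  rfl

section IsQMatrix

variable {ι κ : Type*} [LinearOrder ι] [LinearOrder κ] {u : ι → κ → A}

theorem _root_.IsQMatrix.transpose (h : IsQMatrix q u) : IsQMatrix q fun i j => u j i where
  col i j k hij := h.row i j k hij
  row i j k hij := h.col i j k hij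
  comm i j k l hij hkl := (h.comm k l i j hkl hij).symm
  cross i j k l hij hkl := by
    have := h.cross k l i j hkl hij
    rw [h.comm k l i j hkl hij] at *
    exact this

theorem _root_.IsQMatrix.comp {ι' κ' : Type*} [LinearOrder ι'] [LinearOrder κ']
    (h : IsQMatrix q u) {f : ι' → ι} {g : κ' → κ} (hf : StrictMono f) (hg : StrictMono g) :
    IsQMatrix q fun i j => u (f i) (g j) where
  col _ _ _ hij := h.col _ _ _ (hf hij)
  row _ _ _ hij := h.row _ _ _ (hg hij)
  comm _ _ _ _ hij hkl := h.comm _ _ _ _ (hf hij) (hg hkl)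
  cross _ _ _ _ hij hkl := h.cross _ _ _ _ (hf hij) (hg hkl)

theorem _root_.IsQMatrix.map {B : Type*} [Ring B] [Algebra ℂ B] (h : IsQMatrix q u)
    (φ : A →ₐ[ℂ] B) : IsQMatrix q fun i j => φ (u i j) where
  col i j k hij := by simp only [← map_mul, h.col i j k hij, map_smul]
  row i j k hij := by simp only [← map_mul, h.row i j k hij, map_smul]
  comm i j k l hij hkl := by simp only [← map_mul, h.comm i j k l hij hkl]
  cross i j k l hij hkl := by
    simp only [← map_mul, ← map_sub, h.cross i j k l hij hkl, map_smul]

end IsQMatrix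

/-- The terms of the quantum determinant for `σ` and for `σ` composed with the transposition of
two neighbouring positions combine to a term with a `2 × 2` quantum minor as a factor. -/
theorem det_terms_add {m : ℕ} (k : Fin m) (w : Fin (m + 1) → Fin (m + 1) → A)
    (σ : Equiv.Perm (Fin (m + 1))) (h : σ k.castSucc < σ k.succ) :
    ∃ L R : A, ∀ w' : Fin (m + 1) → Fin (m + 1) → A,
      (∀ a, a ≠ k.castSucc → a ≠ k.succ → w' a = w a) →
      (-q) ^ inv σ • (List.ofFn fun a => w' a (σ a)).prod +
        (-q) ^ inv (σ * Equiv.swap k.castSucc k.succ) •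
          (List.ofFn fun a => w' a ((σ * Equiv.swap k.castSucc k.succ) a)).prod =
      L * (w' k.castSucc (σ k.castSucc) * w' k.succ (σ k.succ) -
        q • (w' k.castSucc (σ k.succ) * w' k.succ (σ k.castSucc))) * R := by
  obtain ⟨L, R, H⟩ := exists_prod_ofFn_eq k fun a => w a (σ a)
  refine ⟨(-q) ^ inv σ • L, R, fun w' hw => ?_⟩
  have h1 : inv (σ * Equiv.swap k.castSucc k.succ) = inv σ + 1 := by
    rw [Equiv.Perm.coe_mul]; exact inv_comp_swap _ k h
  rw [h1, H _ fun a h1 h2 => by simp [hw a h1 h2], H _ fun a h1 h2 => by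
    simp [hw a h1 h2, Equiv.swap_apply_of_ne_of_ne h1 h2]]
  simp only [Equiv.Perm.mul_apply, Equiv.swap_apply_left, Equiv.swap_apply_right, mul_sub, sub_mul,
    smul_mul_assoc, mul_smul_comm, pow_succ]
  module

/-- A combination of quantum determinants of matrices that differ only in two neighbouring rows
vanishes if the same combination of the `2 × 2` quantum minors of these two rows vanishes. -/
theorem det_add_smul_det_eq_zero {m : ℕ} (k : Fin m) (c d : ℂ)
    (w w' : Fin (m + 1) → Fin (m + 1) → A)
    (hw : ∀ a, a ≠ k.castSucc → a ≠ k.succ → w' a = w a)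
    (H : ∀ a b, a < b →
      c • (w k.castSucc a * w k.succ b - q • (w k.castSucc b * w k.succ a)) +
      d • (w' k.castSucc a * w' k.succ b - q • (w' k.castSucc b * w' k.succ a)) = 0) :
    c • det q w + d • det q w' = 0 := by
  have key : ∀ σ : Equiv.Perm (Fin (m + 1)), σ k.castSucc < σ k.succ →
      (c • ((-q) ^ inv σ • (List.ofFn fun a => w a (σ a)).prod) +
        d • ((-q) ^ inv σ • (List.ofFn fun a => w' a (σ a)).prod)) +
      (c • ((-q) ^ inv (σ * Equiv.swap k.castSucc k.succ) •
          (List.ofFn fun a => w a ((σ * Equiv.swap k.castSucc k.succ) a)).prod) +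
        d • ((-q) ^ inv (σ * Equiv.swap k.castSucc k.succ) •
          (List.ofFn fun a => w' a ((σ * Equiv.swap k.castSucc k.succ) a)).prod)) = 0 := by
    intro σ hσ
    obtain ⟨L, R, h⟩ := det_terms_add (q := q) k w σ hσ
    have h1 := h w fun _ _ _ => rfl
    have h2 := h w' hw
    rw [add_add_add_comm, ← smul_add, ← smul_add, h1, h2]
    have h3 := congrArg (fun x => L * x * R) (H _ _ hσ)
    simp only [mul_add, add_mul, mul_smul_comm, smul_mul_assoc, mul_zero, zero_mul] at h3
    exact h3
  rw [det, det, Finset.smul_sum, Finset.smul_sum, ← Finset.sum_add_distrib]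
  refine Finset.sum_involution (fun σ _ => σ * Equiv.swap k.castSucc k.succ) ?_ ?_ ?_ ?_
  · intro σ _
    have hne : σ k.castSucc ≠ σ k.succ := fun h =>
      (Fin.castSucc_lt_succ (i := k)).ne (σ.injective h)
    rcases lt_or_gt_of_ne hne with h | h
    · exact key σ h
    · have := key (σ * Equiv.swap k.castSucc k.succ) (by simpa using h)
      rw [mul_assoc, Equiv.swap_mul_self, mul_one] at this
      rw [add_comm]
      exact this
  · intro σ _ _ h
    have := (mul_eq_left.mp h)
    rw [Equiv.swap_eq_one_iff] at this
    exact (Fin.castSucc_lt_succ (i := k)).ne this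
  · simp
  · intro σ _
    rw [mul_assoc, Equiv.swap_mul_self, mul_one]

variable {ι : Type*} [LinearOrder ι]

/-- The determinant vanishes if two neighbouring rows agree, since then the `2 × 2` quantum minors
of these two rows vanish. -/
theorem det_eq_zero_of_adjacent {m : ℕ} {u : ι → Fin (m + 1) → A} (hu : IsQMatrix q u)
    (f : Fin (m + 1) → ι) (k : Fin m) (h : f k.castSucc = f k.succ) :
    det q (fun i => u (f i)) = 0 := by
  have := det_add_smul_det_eq_zero (q := q) k 1 0 (fun i => u (f i)) (fun i => u (f i))
    (fun _ _ _ => rfl) fun a b hab => by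
      simp [h, hu.row _ _ _ hab]
  simpa using this

/-- Exchanging two neighbouring rows in increasing order multiplies the determinant by `-q`, since
it does so for the `2 × 2` quantum minors of these two rows. -/
theorem det_comp_swap {m : ℕ} {u : ι → Fin (m + 1) → A} (hu : IsQMatrix q u) (hq : q ≠ 0)
    (f : Fin (m + 1) → ι) (k : Fin m) (h : f k.castSucc < f k.succ) :
    det q (fun i => u (f (Equiv.swap k.castSucc k.succ i))) = (-q) • det q fun i => u (f i) := by
  have := det_add_smul_det_eq_zero (q := q) k q 1 (fun i => u (f i))
    (fun i => u (f (Equiv.swap k.castSucc k.succ i)))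
    (fun a h1 h2 => by simp [Equiv.swap_apply_of_ne_of_ne h1 h2]) fun a b hab => by
      simp only [Equiv.swap_apply_left, Equiv.swap_apply_right]
      have h1 := hu.comm _ _ _ _ h hab
      have h2 := sub_eq_iff_eq_add.mp (hu.cross _ _ _ _ h hab)
      rw [h1, h2]
      match_scalars <;> field_simp <;> ring
  rw [one_smul] at this
  rw [neg_smul, eq_neg_iff_add_eq_zero, add_comm]
  exact this

/-- The quantum sign of a map: `(-q)` to the number of inversions of an injective map, and zero
for other maps. -/
def sign (q : ℂ) {m : ℕ} (f : Fin m → Fin m) : ℂ :=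
  if Function.Injective f then (-q) ^ inv f else 0

theorem sign_perm {m : ℕ} (σ : Equiv.Perm (Fin m)) : sign q σ = (-q) ^ inv σ :=
  if_pos σ.injective

theorem inv_id {m : ℕ} : inv (id : Fin m → Fin m) = 0 := by
  simp only [inv, Finset.card_eq_zero, Finset.filter_eq_empty_iff]
  rintro ⟨a, b⟩ - ⟨h1, h2⟩
  exact lt_asymm h1 h2

theorem sign_id {m : ℕ} : sign q (id : Fin m → Fin m) = 1 := by
  rw [sign, if_pos Function.injective_id, inv_id, pow_zero]

/-- Permuting the rows of a quantum matrix multiplies the quantum determinant by the quantum sign,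
and the quantum determinant vanishes if a row is repeated. -/
theorem det_comp {m : ℕ} {u : Fin m → Fin m → A} (hu : IsQMatrix q u) (hq : q ≠ 0)
    (f : Fin m → Fin m) : det q (fun i => u (f i)) = sign q f • det q u := by
  rcases m with _ | m
  · obtain rfl : f = id := Subsingleton.elim _ _
    simp [sign_id]
  -- sort the rows by transpositions of neighbours
  induction hN : inv f using Nat.strong_induction_on generalizing f with
  | _ N ih =>
  by_cases hmono : ∀ k : Fin m, f k.castSucc ≤ f k.succ
  · by_cases hstrict : ∀ k : Fin m, f k.castSucc < f k.succ
    · -- a strictly increasing self-map of `Fin (m + 1)` is the identity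
      have : f = id := (Fin.strictMono_iff_lt_succ.mpr hstrict).eq_id
      subst this
      simp [sign_id]
    · push Not at hstrict
      obtain ⟨k, hk⟩ := hstrict
      have h := le_antisymm (hmono k) hk
      rw [det_eq_zero_of_adjacent hu f k h, sign, if_neg, zero_smul]
      exact fun hf => (Fin.castSucc_lt_succ (i := k)).ne (hf h)
  · push Not at hmono
    obtain ⟨k, hk⟩ := hmono
    set s := Equiv.swap k.castSucc k.succ
    have hfs : f = (f ∘ s) ∘ s := by funext; simp [s]
    have hlt : (f ∘ s) k.castSucc < (f ∘ s) k.succ := by simpa [s] using hk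
    have hinv : inv f = inv (f ∘ s) + 1 := by
      conv_lhs => rw [hfs]
      exact inv_comp_swap _ k hlt
    have hdet := det_comp_swap hu hq (f ∘ s) k hlt
    have hih := ih _ (by omega) (f ∘ s) rfl
    simp only [Function.comp_apply] at hdet hih
    simp only [s, Equiv.swap_apply_self] at hdet
    rw [hdet, hih, smul_smul]
    congr 1
    have hiff : Function.Injective (f ∘ s) ↔ Function.Injective f := s.injective_comp f
    by_cases hf : Function.Injective f
    · rw [sign, sign, if_pos hf, if_pos (hiff.mpr hf), hinv, pow_succ']
    · rw [sign, sign, if_neg hf, if_neg (mt hiff.mp hf), mul_zero]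

/-- The sum of the `q ^ (2 * |σ|)` is positive for real `q`: the identity contributes `1`. -/
theorem sum_inv_ne_zero {q : ℝ} {m : ℕ} :
    ∑ σ : Equiv.Perm (Fin m), (-(q : ℂ)) ^ inv σ * (-(q : ℂ)) ^ inv σ ≠ 0 := by
  have : 0 < ∑ σ : Equiv.Perm (Fin m), (-q) ^ inv σ * (-q) ^ inv σ := by
    refine Finset.sum_pos' (fun σ _ => mul_self_nonneg _) ⟨1, Finset.mem_univ _, ?_⟩
    rw [Equiv.Perm.coe_one, inv_id]
    simp
  exact_mod_cast this.ne'

/-- The quantum determinant does not change under transposition. For real `q` this follows by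
evaluating `∑ σ τ, (-q)^(|σ| + |τ|) u_{τ(1) σ(1)} ⋯ u_{τ(m) σ(m)}` in two ways, since
`∑ σ, q^(2|σ|)` is positive. -/
theorem det_transpose {q : ℝ} {m : ℕ} {u : Fin m → Fin m → A} (hu : IsQMatrix (q : ℂ) u)
    (hq : q ≠ 0) : det (q : ℂ) (fun i j => u j i) = det (q : ℂ) u := by
  have hq' : (q : ℂ) ≠ 0 := by exact_mod_cast hq
  have h1 := fun τ : Equiv.Perm (Fin m) => det_comp hu hq' τ
  have h2 := fun τ : Equiv.Perm (Fin m) => det_comp hu.transpose hq' τ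
  have h3 : ∑ τ : Equiv.Perm (Fin m), (-(q : ℂ)) ^ inv τ • det (q : ℂ) (fun i => u (τ i)) =
      ∑ τ : Equiv.Perm (Fin m), (-(q : ℂ)) ^ inv τ • det (q : ℂ) (fun i j => u j (τ i)) := by
    simp only [det, Finset.smul_sum]
    rw [Finset.sum_comm]
    exact Finset.sum_congr rfl fun _ _ => Finset.sum_congr rfl fun _ _ => smul_comm _ _ _
  simp only [h1, h2, sign_perm, smul_smul, ← Finset.sum_smul] at h3
  exact (smul_right_injective A sum_inv_ne_zero h3).symm

end QMatrix

namespace QMatrix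

/-! ### Laplace expansions -/

theorem inv_succ {m : ℕ} {ι : Type*} [LinearOrder ι] (f : Fin (m + 1) → ι) :
    inv f = (Finset.univ.filter fun b : Fin m => f b.succ < f 0).card +
      inv fun b : Fin m => f b.succ := by
  simp only [inv, Finset.card_filter, Fintype.sum_prod_type, Fin.sum_univ_succ]
  simp [-Finset.sum_boole]

theorem inv_castSucc {m : ℕ} {ι : Type*} [LinearOrder ι] (f : Fin (m + 1) → ι) :
    inv f = (Finset.univ.filter fun b : Fin m => f (Fin.last m) < f b.castSucc).card +
      inv fun b : Fin m => f b.castSucc := by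
  simp only [inv, Finset.card_filter, Fintype.sum_prod_type, Fin.sum_univ_castSucc]
  simp [-Finset.sum_boole, Fin.castSucc_lt_last, Finset.sum_add_distrib, add_comm,
    (Fin.le_last _).not_gt]

theorem inv_strictMono {m : ℕ} {ι : Type*} [LinearOrder ι] {f : Fin m → ι} (hf : StrictMono f) :
    inv f = 0 := by
  simp only [inv, Finset.card_eq_zero, Finset.filter_eq_empty_iff]
  rintro ⟨a, b⟩ - ⟨h1, h2⟩
  exact lt_asymm (hf h1) h2

theorem inv_strictMono_comp {m n : ℕ} {ι : Type*} [LinearOrder ι] {f : Fin n → ι}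
    (hf : StrictMono f) (g : Fin m → Fin n) : inv (fun a => f (g a)) = inv g := by
  simp only [inv, hf.lt_iff_lt]

theorem card_succAbove_lt {m : ℕ} (j : Fin (m + 1)) :
    (Finset.univ.filter fun b : Fin m => j.succAbove b < j).card = j := by
  simp only [Fin.succAbove_lt_iff_castSucc_lt]
  simp only [Fin.lt_def, Fin.val_castSucc]
  have := j.is_le
  simp [Fin.card_filter_val_lt, this]

theorem card_lt_succAbove {m : ℕ} (j : Fin (m + 1)) :
    (Finset.univ.filter fun b : Fin m => j < j.succAbove b).card = m - j := by
  have h := Finset.card_filter_add_card_filter_not (s := (Finset.univ : Finset (Fin m)))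
    (fun b : Fin m => j.succAbove b < j)
  have h' : ∀ b : Fin m, ¬ j.succAbove b < j ↔ j < j.succAbove b := fun b =>
    not_lt.trans ⟨fun h => lt_of_le_of_ne h (Fin.succAbove_ne j b).symm, le_of_lt⟩
  simp only [h', card_succAbove_lt, Finset.card_univ, Fintype.card_fin] at h
  omega

/-- The permutation which maps `i` to `j` and the other elements, in order, as `σ` does. -/
def extendPerm {m : ℕ} (i j : Fin (m + 1)) (σ : Equiv.Perm (Fin m)) : Equiv.Perm (Fin (m + 1)) :=
  ((finSuccEquiv' i).trans (Equiv.optionCongr σ)).trans (finSuccEquiv' j).symm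

theorem extendPerm_self {m : ℕ} (i j : Fin (m + 1)) (σ : Equiv.Perm (Fin m)) :
    extendPerm i j σ i = j := by
  simp [extendPerm]

theorem extendPerm_succAbove {m : ℕ} (i j : Fin (m + 1)) (σ : Equiv.Perm (Fin m)) (k : Fin m) :
    extendPerm i j σ (i.succAbove k) = j.succAbove (σ k) := by
  simp [extendPerm]

theorem extendPerm_bijective {m : ℕ} (i : Fin (m + 1)) :
    Function.Bijective fun p : Fin (m + 1) × Equiv.Perm (Fin m) => extendPerm i p.1 p.2 := by
  rw [Fintype.bijective_iff_injective_and_card]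
  constructor
  · rintro ⟨j, σ⟩ ⟨j', σ'⟩ h
    have h1 := congrArg (fun τ => τ i) h
    simp only [extendPerm_self] at h1
    subst h1
    congr 1
    ext k : 1
    have h2 := congrArg (fun τ => τ (i.succAbove k)) h
    simp only [extendPerm_succAbove] at h2
    exact Fin.succAbove_right_injective h2
  · simp [Fintype.card_perm, Nat.factorial_succ]

variable {q : ℂ} {A : Type*} [Ring A] [Algebra ℂ A]

theorem det_eq_sum_first_row {m : ℕ} (w : Fin (m + 1) → Fin (m + 1) → A) :
    det q w = ∑ j : Fin (m + 1), (-q) ^ (j : ℕ) •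
      (w 0 j * det q fun a b => w a.succ (j.succAbove b)) := by
  simp only [det, Finset.mul_sum, Finset.smul_sum]
  rw [← Fintype.sum_prod_type', ← (extendPerm_bijective 0).sum_comp]
  refine Finset.sum_congr rfl fun p _ => ?_
  have h : ∀ k : Fin m, extendPerm 0 p.1 p.2 k.succ = p.1.succAbove (p.2 k) := fun k => by
    rw [← Fin.succAbove_zero, extendPerm_succAbove]
  have hinv : inv (extendPerm 0 p.1 p.2) = p.1 + inv p.2 := by
    rw [inv_succ]
    simp only [h, extendPerm_self, inv_strictMono_comp (Fin.strictMono_succAbove p.1)]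
    rw [← Finset.card_map p.2.toEmbedding]
    conv_rhs => rw [← card_succAbove_lt p.1]
    congr 2
    ext b
    simp
  rw [hinv, List.ofFn_succ, List.prod_cons, extendPerm_self, mul_smul_comm, smul_smul, pow_add]
  simp only [h]

theorem det_eq_sum_last_row {m : ℕ} (w : Fin (m + 1) → Fin (m + 1) → A) :
    det q w = ∑ j : Fin (m + 1), (-q) ^ (m - j : ℕ) •
      ((det q fun a b => w a.castSucc (j.succAbove b)) * w (Fin.last m) j) := by
  simp only [det, Finset.sum_mul, Finset.smul_sum]
  rw [← Fintype.sum_prod_type', ← (extendPerm_bijective (Fin.last m)).sum_comp]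
  refine Finset.sum_congr rfl fun p _ => ?_
  have h : ∀ k : Fin m, extendPerm (Fin.last m) p.1 p.2 k.castSucc = p.1.succAbove (p.2 k) :=
    fun k => by rw [← Fin.succAbove_last, extendPerm_succAbove]
  have hinv : inv (extendPerm (Fin.last m) p.1 p.2) = m - p.1 + inv p.2 := by
    rw [inv_castSucc]
    simp only [h, extendPerm_self, inv_strictMono_comp (Fin.strictMono_succAbove p.1)]
    rw [← Finset.card_map p.2.toEmbedding]
    conv_rhs => rw [← card_lt_succAbove p.1]
    congr 2
    ext b
    simp
  rw [hinv, List.ofFn_succ', List.concat_eq_append, List.prod_append, List.prod_singleton,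
    extendPerm_self, smul_mul_assoc, smul_smul, pow_add]
  simp only [h]

/-- The quantum minor without row `i` and column `j`. -/
def minor (q : ℂ) {m : ℕ} (u : Fin (m + 1) → Fin (m + 1) → A) (i j : Fin (m + 1)) : A :=
  det q fun a b => u (i.succAbove a) (j.succAbove b)

/-- The quantum sign of the rows `k` and then all except `i`: for `k = i` the inversions are the `i`
pairs of row `i` with the smaller ones, and otherwise row `k` is repeated. -/
theorem sign_cons {m : ℕ} (i k : Fin (m + 1)) :
    sign q (Fin.cons k i.succAbove : Fin (m + 1) → Fin (m + 1)) =
      if k = i then (-q) ^ (i : ℕ) else 0 := by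
  have hinj : Function.Injective (Fin.cons k i.succAbove : Fin (m + 1) → Fin (m + 1)) ↔ k = i := by
    rw [Fin.cons_injective_iff, Fin.range_succAbove]
    simp [Fin.succAbove_right_injective]
  rw [sign]
  refine if_ctx_congr hinj ?_ fun _ => rfl
  rintro rfl
  rw [inv_succ]
  simp [card_succAbove_lt, inv_strictMono (Fin.strictMono_succAbove k)]

/-- The quantum sign of all rows except `i` and then `k`: for `k = i` the inversions are the `m - i`
pairs of row `i` with the larger ones, and otherwise row `k` is repeated. -/
theorem sign_snoc {m : ℕ} (i k : Fin (m + 1)) :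
    sign q (Fin.snoc (α := fun _ => Fin (m + 1)) i.succAbove k) =
      if k = i then (-q) ^ (m - i : ℕ) else 0 := by
  have hinj : Function.Injective (Fin.snoc (α := fun _ => Fin (m + 1)) i.succAbove k) ↔
      k = i := by
    rw [Fin.snoc_injective_iff, Fin.range_succAbove]
    simp [Fin.succAbove_right_injective]
  rw [sign]
  refine if_ctx_congr hinj ?_ fun _ => rfl
  rintro rfl
  rw [inv_castSucc]
  simp [card_lt_succAbove, inv_strictMono (Fin.strictMono_succAbove k)]

/-- The expansion along the first row of the matrix with row `k` of `u` on top of all rows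
except `i`. -/
theorem sum_mul_minor {m : ℕ} {u : Fin (m + 1) → Fin (m + 1) → A} (hu : IsQMatrix q u)
    (hq : q ≠ 0) (i k : Fin (m + 1)) :
    ∑ j : Fin (m + 1), (-q) ^ (j : ℕ) • (u k j * minor q u i j) =
      (if k = i then (-q) ^ (i : ℕ) else 0) • det q u := by
  rw [← sign_cons, ← det_comp hu hq, det_eq_sum_first_row]
  rfl

/-- The expansion along the last row of the matrix with row `k` of `u` below all rows
except `i`. -/
theorem sum_minor_mul {m : ℕ} {u : Fin (m + 1) → Fin (m + 1) → A} (hu : IsQMatrix q u)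
    (hq : q ≠ 0) (i k : Fin (m + 1)) :
    ∑ j : Fin (m + 1), (-q) ^ (m - j : ℕ) • (minor q u i j * u k j) =
      (if k = i then (-q) ^ (m - i : ℕ) else 0) • det q u := by
  rw [← sign_snoc, ← det_comp hu hq, det_eq_sum_last_row]
  simp [minor]

/-- The quantum cofactor of the entry in row `i` and column `j`. The exponent `j - i` of the factor
in front of the minor may be negative. -/
def cof (q : ℂ) : {m : ℕ} → (Fin m → Fin m → A) → Fin m → Fin m → A
  | 0, _, i, _ => i.elim0
  | _ + 1, u, i, j => (-q) ^ ((j : ℤ) - (i : ℤ)) • minor q u i j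

theorem sum_mul_cof {m : ℕ} {u : Fin m → Fin m → A} (hu : IsQMatrix q u) (hq : q ≠ 0)
    (i k : Fin m) : ∑ j, u k j * cof q u i j = if k = i then det q u else 0 := by
  rcases m with _ | m
  · exact i.elim0
  have hq' : -q ≠ 0 := neg_ne_zero.mpr hq
  have h := congrArg (fun x => (-q) ^ (-(i : ℤ)) • x) (sum_mul_minor hu hq i k)
  simp only [Finset.smul_sum, smul_smul] at h
  convert h using 1
  · refine Finset.sum_congr rfl fun j _ => ?_
    rw [cof, mul_smul_comm, sub_eq_neg_add, zpow_add₀ hq', zpow_natCast]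
  · split_ifs
    · rw [zpow_neg, zpow_natCast, inv_mul_cancel₀ (pow_ne_zero _ hq'), one_smul]
    · simp

/-- The cofactors give a left inverse, too. The expansion along columns which this amounts to is
obtained from `sum_minor_mul` for the transposed matrix, as minors do not change under
transposition. -/
theorem sum_cof_mul {q : ℝ} {m : ℕ} {u : Fin m → Fin m → A} (hu : IsQMatrix (q : ℂ) u)
    (hq : q ≠ 0) (i k : Fin m) :
    ∑ j, cof (q : ℂ) u j i * u j k = if k = i then det (q : ℂ) u else 0 := by
  rcases m with _ | m
  · exact i.elim0
  have hq0 : (q : ℂ) ≠ 0 := by exact_mod_cast hq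
  have hq' : -(q : ℂ) ≠ 0 := neg_ne_zero.mpr hq0
  have h := congrArg (fun x => (-(q : ℂ)) ^ ((i : ℤ) - m) • x) (sum_minor_mul hu.transpose hq0 i k)
  simp only [Finset.smul_sum, smul_smul] at h
  rw [det_transpose hu hq] at h
  convert h using 1
  · refine Finset.sum_congr rfl fun j _ => ?_
    have hmin : minor (q : ℂ) (fun i j => u j i) i j = minor (q : ℂ) u j i :=
      det_transpose (hu.comp (Fin.strictMono_succAbove j) (Fin.strictMono_succAbove i)) hq
    rw [hmin, cof, smul_mul_assoc, ← zpow_natCast, ← zpow_add₀ hq', Nat.cast_sub j.is_le]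
    congr 2
    ring
  · split_ifs
    · rw [← zpow_natCast, ← zpow_add₀ hq', Nat.cast_sub i.is_le, sub_add_sub_cancel, sub_self,
        zpow_zero, one_smul]
    · simp

theorem map_cof {B : Type*} [Ring B] [Algebra ℂ B] (φ : A →ₐ[ℂ] B) {m : ℕ}
    (u : Fin m → Fin m → A) (i j : Fin m) :
    φ (cof q u i j) = cof q (fun i j => φ (u i j)) i j := by
  rcases m with _ | m
  · exact i.elim0
  · rw [cof, map_smul, minor, map_det]
    rfl

end QMatrix

namespace QMatrix

variable {q : ℂ} {A : Type*} [Ring A] [Algebra ℂ A]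

/-! ### Products and inverses of quantum matrices -/

section RTT

variable {ι : Type*} [LinearOrder ι]

/-- The coefficient of the flip in the standard solution of the braid equation. -/
def flipCoeff (q : ℂ) (i j : ι) : ℂ := if i = j then q else 1

/-- The coefficient of the identity in the standard solution of the braid equation. -/
def idCoeff (q : ℂ) (i j : ι) : ℂ := if i < j then q - q⁻¹ else 0

/-- The quadratic relations as one family of equations. It says that the matrix with the entries
`u i k * u j l` commutes with the standard solution of the braid equation. -/
theorem isQMatrix_iff (hq : q ≠ 0) {u : ι → ι → A} : IsQMatrix q u ↔ ∀ i j k l,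
    flipCoeff q i j • (u j k * u i l) + idCoeff q i j • (u i k * u j l) =
      flipCoeff q k l • (u i l * u j k) + idCoeff q k l • (u i k * u j l) := by
  constructor
  · intro h i j k l
    rcases lt_trichotomy i j with hij | rfl | hij <;> rcases lt_trichotomy k l with hkl | rfl | hkl
    · simp [flipCoeff, idCoeff, hij, hij.ne, hkl, hkl.ne, h.comm _ _ _ _ hij hkl]
    · simp only [flipCoeff, idCoeff, hij, hij.ne, lt_irrefl, h.col _ _ k hij, if_true, if_false]
      match_scalars
      field_simp
      ring
    · simp only [flipCoeff, idCoeff, hij, hij.ne, hkl.not_gt, hkl.ne', if_true, if_false]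
      rw [sub_eq_iff_eq_add.mp (h.cross _ _ _ _ hij hkl),
        h.comm _ _ _ _ hij hkl]
      module
    · simp only [flipCoeff, idCoeff, lt_irrefl, h.row _ _ i hkl, hkl, hkl.ne, if_true, if_false]
      match_scalars
      field_simp
      ring
    · simp [flipCoeff, idCoeff]
    · simp [flipCoeff, idCoeff, hkl.ne', hkl.not_gt, h.row _ _ i hkl]
    · simp only [flipCoeff, idCoeff, hij.not_gt, hij.ne', hkl, hkl.ne, if_true, if_false]
      rw [sub_eq_iff_eq_add.mp (h.cross _ _ _ _ hij hkl)]
      module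
    · simp [flipCoeff, idCoeff, hij.ne', hij.not_gt, h.col _ _ k hij]
    · simp [flipCoeff, idCoeff, hij.ne', hij.not_gt, hkl.ne', hkl.not_gt, h.comm _ _ _ _ hij hkl]
  · intro h
    have hcomm : ∀ i j k l, i < j → k < l → u i l * u j k = u j k * u i l := by
      intro i j k l hij hkl
      have := h i j k l
      simp only [flipCoeff, idCoeff, hij, hij.ne, hkl, hkl.ne, if_true, if_false, one_smul,
        add_left_inj] at this
      exact this.symm
    refine ⟨fun i j k hij => ?_, fun i j k hij => ?_, hcomm, fun i j k l hij hkl => ?_⟩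
    · have := h j i k k
      simpa [flipCoeff, idCoeff, hij.ne', hij.not_gt] using this
    · have := h k k j i
      simpa [flipCoeff, idCoeff, hij.ne', hij.not_gt] using this.symm
    · have := h i j l k
      simp only [flipCoeff, idCoeff, hij, hij.ne, hkl.not_gt, hkl.ne', if_true, if_false, one_smul,
        zero_smul, add_zero] at this
      rw [← this, ← hcomm _ _ _ _ hij hkl]
      abel

variable [Fintype ι]

/-- The standard solution of the braid equation, as a matrix over `A`. -/
def braidMatrix (q : ℂ) (ι A : Type*) [LinearOrder ι] [Ring A] [Algebra ℂ A] :
    Matrix (ι × ι) (ι × ι) A :=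
  Matrix.of fun p r => (if p.swap = r then algebraMap ℂ A (flipCoeff q p.1 p.2) else 0) +
    (if p = r then algebraMap ℂ A (idCoeff q p.1 p.2) else 0)

theorem braidMatrix_mul_apply (M : Matrix (ι × ι) (ι × ι) A) (i j k l : ι) :
    (braidMatrix q ι A * M) (i, j) (k, l) =
      flipCoeff q i j • M (j, i) (k, l) + idCoeff q i j • M (i, j) (k, l) := by
  simp [braidMatrix, Matrix.mul_apply, add_mul, Finset.sum_add_distrib, ite_mul, Algebra.smul_def]

theorem mul_braidMatrix_apply (M : Matrix (ι × ι) (ι × ι) A) (i j k l : ι) :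
    (M * braidMatrix q ι A) (i, j) (k, l) =
      flipCoeff q k l • M (i, j) (l, k) + idCoeff q k l • M (i, j) (k, l) := by
  have h : ∀ p : ι × ι, p.swap = (k, l) ↔ p = (l, k) := fun p => by
    rw [Prod.swap_eq_iff_eq_swap, Prod.swap_prod_mk]
  have h1 : flipCoeff q l k = flipCoeff q k l := by simp [flipCoeff, eq_comm]
  simp [braidMatrix, Matrix.mul_apply, mul_add, Finset.sum_add_distrib, mul_ite, Algebra.smul_def,
    h, h1, Algebra.commutes]

/-- The square of a matrix in the sense of tensor products, with entries `u i k * u j l`. -/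
def tensorSquare (u : ι → ι → A) : Matrix (ι × ι) (ι × ι) A :=
  Matrix.of fun p r => u p.1 r.1 * u p.2 r.2

theorem isQMatrix_iff_commute (hq : q ≠ 0) {u : ι → ι → A} :
    IsQMatrix q u ↔ Commute (braidMatrix q ι A) (tensorSquare u) := by
  rw [isQMatrix_iff hq, Commute, SemiconjBy, ← Matrix.ext_iff, Prod.forall]
  simp only [Prod.forall, braidMatrix_mul_apply, mul_braidMatrix_apply, tensorSquare,
    Matrix.of_apply]

theorem _root_.IsQMatrix.mul (hq : q ≠ 0) {u v : ι → ι → A} (hu : IsQMatrix q u)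
    (hv : IsQMatrix q v) (h : ∀ i j k l, Commute (u i j) (v k l)) :
    IsQMatrix q fun i j => ∑ k, u i k * v k j := by
  rw [isQMatrix_iff_commute hq] at *
  have : tensorSquare (fun i j => ∑ k, u i k * v k j) = tensorSquare u * tensorSquare v := by
    ext ⟨i, j⟩ ⟨k, l⟩
    simp only [tensorSquare, Matrix.of_apply, Matrix.mul_apply, Finset.sum_mul_sum,
      Fintype.sum_prod_type]
    refine Finset.sum_congr rfl fun a _ => Finset.sum_congr rfl fun b _ => ?_
    rw [mul_assoc, mul_assoc, ← mul_assoc (v a k), ← (h j b a k).eq, mul_assoc]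
  rw [this]
  exact hu.mul_right hv

/-- The inverse of a quantum matrix is a quantum matrix over the opposite algebra. -/
theorem _root_.IsQMatrix.op_inv (hq : q ≠ 0) {u v : ι → ι → A} (hu : IsQMatrix q u)
    (huv : ∀ i j, ∑ k, u i k * v k j = if i = j then 1 else 0)
    (hvu : ∀ i j, ∑ k, v i k * u k j = if i = j then 1 else 0) :
    IsQMatrix q fun i j => MulOpposite.op (v i j) := by
  let Y : Matrix (ι × ι) (ι × ι) A := Matrix.of fun p r => v p.2 r.2 * v p.1 r.1
  have h1 : tensorSquare u * Y = 1 := by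
    ext ⟨i, j⟩ ⟨k, l⟩
    have : ∀ a, ∑ b, u i a * u j b * (v b l * v a k) =
        u i a * (∑ b, u j b * v b l) * v a k := fun a => by
      simp only [Finset.mul_sum, Finset.sum_mul, mul_assoc]
    simp only [tensorSquare, Y, Matrix.of_apply, Matrix.mul_apply, Fintype.sum_prod_type, this,
      huv, Matrix.one_apply, Prod.mk.injEq]
    by_cases hjl : j = l <;> simp [hjl, huv]
  have h2 : Y * tensorSquare u = 1 := by
    ext ⟨i, j⟩ ⟨k, l⟩
    have : ∀ b, ∑ a, v j b * v i a * (u a k * u b l) =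
        v j b * (∑ a, v i a * u a k) * u b l := fun a => by
      simp only [Finset.mul_sum, Finset.sum_mul, mul_assoc]
    simp only [tensorSquare, Y, Matrix.of_apply, Matrix.mul_apply, Fintype.sum_prod_type]
    rw [Finset.sum_comm]
    simp only [this, hvu, Matrix.one_apply, Prod.mk.injEq]
    by_cases hik : i = k <;> simp [hik, hvu]
  let U : (Matrix (ι × ι) (ι × ι) A)ˣ := ⟨tensorSquare u, Y, h1, h2⟩
  have h3 : Commute (braidMatrix q ι A) (U : Matrix (ι × ι) (ι × ι) A) :=
    (isQMatrix_iff_commute hq).mp hu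
  have h4 : Commute (braidMatrix q ι A) Y := h3.units_inv_right
  rw [isQMatrix_iff hq]
  -- the entries of the tensor square of `op v` are the entries of `Y`
  intro i j k l
  have h5 := congrFun (congrFun h4.eq (i, j)) (k, l)
  rw [braidMatrix_mul_apply, mul_braidMatrix_apply] at h5
  simp only [← MulOpposite.op_mul, ← MulOpposite.op_smul, ← MulOpposite.op_add]
  exact congrArg MulOpposite.op h5

end RTT

/-- The product of sums, expanded, for the noncommutative product in increasing order. -/
theorem prod_ofFn_sum {R ι : Type*} [Semiring R] [Fintype ι] :
    ∀ {m : ℕ} (F : Fin m → ι → R),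
    (List.ofFn fun k => ∑ a, F k a).prod = ∑ f : Fin m → ι, (List.ofFn fun k => F k (f k)).prod
  | 0, F => by simp
  | m + 1, F => by
    rw [List.ofFn_succ, List.prod_cons, prod_ofFn_sum, Finset.sum_mul_sum,
      ← (Fin.consEquiv fun _ => ι).sum_comp, Fintype.sum_prod_type]
    simp [Fin.consEquiv, List.ofFn_succ]

theorem prod_ofFn_mul {M : Type*} [Monoid M] : ∀ {m : ℕ} (a b : Fin m → M),
    (∀ i j, Commute (a i) (b j)) →
    (List.ofFn fun k => a k * b k).prod = (List.ofFn a).prod * (List.ofFn b).prod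
  | 0, _, _, _ => by simp
  | m + 1, a, b, h => by
    have hc : Commute (List.ofFn fun k : Fin m => a k.succ).prod (b 0) :=
      Commute.list_prod_left _ _ fun x hx => by
        obtain ⟨k, rfl⟩ := List.mem_ofFn.mp hx
        exact h _ _
    simp only [List.ofFn_succ, List.prod_cons]
    rw [prod_ofFn_mul _ _ fun i j => h i.succ j.succ, mul_assoc, mul_assoc, ← mul_assoc (b 0),
      ← hc.eq, mul_assoc]

/-- The determinant as a sum over all maps, most of which have quantum sign zero. -/
theorem det_eq_sum_sign {m : ℕ} (w : Fin m → Fin m → A) :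
    det q w = ∑ f : Fin m → Fin m, sign q f • (List.ofFn fun k => w k (f k)).prod := by
  rw [det]
  refine Finset.sum_of_injOn (fun σ => ⇑σ) (fun _ _ _ _ h => DFunLike.coe_injective h)
    (fun _ _ => Finset.mem_coe.mpr (Finset.mem_univ _)) (fun f _ hf => ?_) fun σ _ => by
      rw [sign_perm]
  rw [sign, if_neg, zero_smul]
  intro hinj
  exact hf ⟨Equiv.ofBijective f (Finite.injective_iff_bijective.mp hinj), by simp, rfl⟩

/-- The determinant of a product of matrices whose entries commute with each other. Expanding the
products of sums, the coefficient of `∏ u k (f k)` is the determinant of the matrix with rows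
`v (f k)`, which is the quantum sign of `f` times the determinant of `v`. -/
theorem det_mul (hq : q ≠ 0) {m : ℕ} {u v : Fin m → Fin m → A} (hv : IsQMatrix q v)
    (h : ∀ i j k l, Commute (u i j) (v k l)) :
    det q (fun i j => ∑ k, u i k * v k j) = det q u * det q v := by
  rw [det_eq_sum_sign u, Finset.sum_mul]
  simp only [smul_mul_assoc, ← mul_smul_comm, ← det_comp hv hq]
  simp only [det, prod_ofFn_sum, Finset.mul_sum, Finset.smul_sum]
  rw [Finset.sum_comm]
  refine Finset.sum_congr rfl fun f _ => Finset.sum_congr rfl fun σ _ => ?_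
  rw [prod_ofFn_mul _ _ fun i j => h _ _ _ _, mul_smul_comm]

/-- If `v` is a left inverse of `u`, then the tensor power of `v`, with the products of entries taken
in the reverse order, is a left inverse of the tensor power of `u`. -/
theorem sum_prod_op_mul_prod {R ι : Type*} [Semiring R] [Fintype ι] [DecidableEq ι] {u v : ι → ι → R}
    (hvu : ∀ i j, ∑ k, v i k * u k j = if i = j then 1 else 0) : ∀ {m : ℕ} (f h : Fin m → ι),
    ∑ g : Fin m → ι, (List.ofFn fun k => MulOpposite.op (v (f k) (g k))).prod.unop *
      (List.ofFn fun k => u (g k) (h k)).prod = if f = h then 1 else 0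
  | 0, f, h => by simp [Subsingleton.elim f h]
  | m + 1, f, h => by
    have ih := sum_prod_op_mul_prod hvu (fun k => f k.succ) fun k => h k.succ
    rw [← (Fin.consEquiv fun _ => ι).sum_comp, Fintype.sum_prod_type, Finset.sum_comm]
    simp only [Fin.consEquiv, Equiv.coe_fn_mk, List.ofFn_succ, Fin.cons_zero, Fin.cons_succ,
      List.prod_cons, MulOpposite.unop_mul, MulOpposite.unop_op]
    have key : ∀ g : Fin m → ι, ∑ a,
        (List.ofFn fun k => MulOpposite.op (v (f k.succ) (g k))).prod.unop * v (f 0) a *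
          (u a (h 0) * (List.ofFn fun k => u (g k) (h k.succ)).prod) =
        (List.ofFn fun k => MulOpposite.op (v (f k.succ) (g k))).prod.unop *
          (∑ a, v (f 0) a * u a (h 0)) * (List.ofFn fun k => u (g k) (h k.succ)).prod := fun g => by
      simp only [Finset.mul_sum, Finset.sum_mul, mul_assoc]
    have hfh : f = h ↔ f 0 = h 0 ∧ (fun k : Fin m => f k.succ) = fun k => h k.succ := by
      simp only [funext_iff, Fin.forall_fin_succ]
    simp only [key, hvu, hfh]
    by_cases h0 : f 0 = h 0
    · simpa [h0] using ih
    · simp [h0]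

/-- If a quantum matrix has quantum determinant `1`, then so has its inverse, over the opposite
algebra: the vector of quantum signs is fixed by the tensor power of `u`, hence also by its
inverse. -/
theorem det_op_inv (hq : q ≠ 0) {m : ℕ} {u v : Fin m → Fin m → A} (hu : IsQMatrix q u)
    (hvu : ∀ i j, ∑ k, v i k * u k j = if i = j then 1 else 0) (hdet : det q u = 1) :
    det q (fun i j => MulOpposite.op (v i j)) = 1 := by
  have h1 : ∀ g : Fin m → Fin m, ∑ h : Fin m → Fin m,
      sign q h • (List.ofFn fun k => u (g k) (h k)).prod = sign q g • 1 := fun g => by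
    rw [← det_eq_sum_sign fun i => u (g i), det_comp hu hq, hdet]
  apply MulOpposite.unop_injective
  rw [det_eq_sum_sign, MulOpposite.unop_one, Finset.unop_sum]
  calc _ = ∑ g : Fin m → Fin m, (List.ofFn fun k => MulOpposite.op (v k (g k))).prod.unop *
        ∑ h : Fin m → Fin m, sign q h • (List.ofFn fun k => u (g k) (h k)).prod := by
        simp only [h1, mul_smul_comm, mul_one, MulOpposite.unop_smul]
    _ = ∑ h : Fin m → Fin m, sign q h • (if id = h then (1 : A) else 0) := by
        simp only [Finset.mul_sum, mul_smul_comm]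
        rw [Finset.sum_comm]
        simp only [← Finset.smul_sum]
        refine Finset.sum_congr rfl fun h _ => ?_
        rw [← sum_prod_op_mul_prod hvu id h]
        rfl
    _ = 1 := by simp [sign_id]

end QMatrix

namespace SUq

open QMatrix

/-! ### The bialgebra `A(SU_q(n))` -/

/-- The complex algebra structure of the quotient. This and the other structures on `A(SU_q(n))` are
scoped instances, as the result asserts the existence of such structures and must not find them by
instance resolution. -/
scoped instance instAlgebra (n : ℕ) (q : ℝ) : Algebra ℂ (SUq n q) :=
  inferInstanceAs (Algebra ℂ (RingQuot (Rel n q)))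

/-- The quotient map from the free algebra, as a map of complex algebras. -/
def mkAlg (n : ℕ) (q : ℝ) : Free n →ₐ[ℂ] SUq n q := RingQuot.mkAlgHom ℂ (Rel n q)

theorem mkAlg_apply (n : ℕ) (q : ℝ) (x : Free n) : mkAlg n q x = mk n q x :=
  congrArg (fun f : Free n →+* RingQuot (Rel n q) => f x) (RingQuot.mkAlgHom_coe ℂ (Rel n q))

theorem mkAlg_gen {n : ℕ} {q : ℝ} (i j : Fin n) : mkAlg n q (gen i j) = u n q i j :=
  mkAlg_apply n q _

theorem mkAlg_eq_of_rel {n : ℕ} {q : ℝ} {x y : Free n} (h : Rel n q x y) :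
    mkAlg n q x = mkAlg n q y :=
  RingQuot.mkAlgHom_rel ℂ h

theorem isQMatrix_u (n : ℕ) (q : ℝ) : IsQMatrix (q : ℂ) (u n q) where
  col i j k hij := by
    simpa only [map_mul, map_smul, mkAlg_gen] using mkAlg_eq_of_rel (Rel.col (q := q) i j k hij)
  row i j k hij := by
    simpa only [map_mul, map_smul, mkAlg_gen] using mkAlg_eq_of_rel (Rel.row (q := q) i j k hij)
  comm i j k l hij hkl := by
    simpa [mkAlg_gen] using mkAlg_eq_of_rel (Rel.comm (q := q) i j k l hij hkl)
  cross i j k l hij hkl := by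
    simpa [mkAlg_gen] using mkAlg_eq_of_rel (Rel.cross (q := q) i j k l hij hkl)

/-- The two definitions agree, as `inversions σ` is `inv σ` by definition. -/
theorem qdet_eq_det (n : ℕ) (q : ℝ) : qdet n q = det (q : ℂ) (gen (n := n)) := rfl

theorem cofactor_eq_cof {n : ℕ} (q : ℝ) (i j : Fin n) :
    cofactor q i j = cof (q : ℂ) (gen (n := n)) i j := by
  rcases n with _ | n
  · exact i.elim0
  · rfl

theorem det_u (n : ℕ) (q : ℝ) : det (q : ℂ) (u n q) = 1 := by
  have h := mkAlg_eq_of_rel (Rel.det (n := n) (q := q))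
  rw [qdet_eq_det, map_det, map_one] at h
  simpa only [mkAlg_gen] using h

theorem mk_cofactor {n : ℕ} (q : ℝ) (i j : Fin n) :
    mk n q (cofactor q i j) = cof (q : ℂ) (u n q) i j := by
  rw [← mkAlg_apply, cofactor_eq_cof, map_cof]
  simp only [mkAlg_gen]

/-- The universal property of `A(SU_q(n))`. -/
def lift {n : ℕ} {q : ℝ} {B : Type*} [Ring B] [Algebra ℂ B] (v : Fin n → Fin n → B)
    (hv : IsQMatrix (q : ℂ) v) (hdet : det (q : ℂ) v = 1) : SUq n q →ₐ[ℂ] B :=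
  RingQuot.liftAlgHom ℂ ⟨FreeAlgebra.lift ℂ fun p => v p.1 p.2, by
    have hgen : ∀ i j, FreeAlgebra.lift ℂ (fun p : Fin n × Fin n => v p.1 p.2) (gen i j) = v i j :=
      fun i j => FreeAlgebra.lift_ι_apply _ _
    intro x y h
    cases h with
    | col i j k hij => simpa only [map_mul, map_smul, hgen] using hv.col i j k hij
    | row i j k hij => simpa only [map_mul, map_smul, hgen] using hv.row i j k hij
    | comm i j k l hij hkl => simpa [hgen] using hv.comm i j k l hij hkl
    | cross i j k l hij hkl => simpa [hgen] using hv.cross i j k l hij hkl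
    | det =>
      rw [qdet_eq_det, map_det, map_one]
      simpa only [hgen] using hdet⟩

theorem lift_u {n : ℕ} {q : ℝ} {B : Type*} [Ring B] [Algebra ℂ B] (v : Fin n → Fin n → B)
    (hv : IsQMatrix (q : ℂ) v) (hdet : det (q : ℂ) v = 1) (i j : Fin n) :
    lift v hv hdet (u n q i j) = v i j := by
  rw [← mkAlg_gen]
  exact (RingQuot.liftAlgHom_mkAlgHom_apply ℂ _ _ _).trans (FreeAlgebra.lift_ι_apply _ _)

theorem algHom_ext {n : ℕ} {q : ℝ} {B : Type*} [Ring B] [Algebra ℂ B] {f g : SUq n q →ₐ[ℂ] B}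
    (h : ∀ i j, f (u n q i j) = g (u n q i j)) : f = g := by
  refine RingQuot.ringQuot_ext' (S := ℂ) f g (FreeAlgebra.hom_ext ?_)
  funext p
  have := h p.1 p.2
  rw [← mkAlg_gen] at this
  exact this

theorem induction {n : ℕ} {q : ℝ} {P : SUq n q → Prop} (algebraMap : ∀ c : ℂ, P (algebraMap ℂ _ c))
    (u : ∀ i j, P (u n q i j)) (add : ∀ x y, P x → P y → P (x + y))
    (mul : ∀ x y, P x → P y → P (x * y)) (x : SUq n q) : P x := by
  obtain ⟨x, rfl⟩ := RingQuot.mkAlgHom_surjective ℂ (Rel n q) x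
  change P (mkAlg n q x)
  induction x using FreeAlgebra.induction with
  | grade0 c => rw [AlgHom.commutes]; exact algebraMap c
  | grade1 p => exact mkAlg_gen (q := q) p.1 p.2 ▸ u p.1 p.2
  | mul x y hx hy => rw [map_mul]; exact mul _ _ hx hy
  | add x y hx hy => rw [map_add]; exact add _ _ hx hy

variable {n : ℕ} {q : ℝ}

theorem coe_ne_zero_of_neZero [NeZero q] : (q : ℂ) ≠ 0 := by exact_mod_cast NeZero.ne q

/-- A diagonal matrix over a commutative algebra is a quantum matrix. -/
theorem isQMatrix_diagonal {B : Type*} [CommRing B] [Algebra ℂ B] (d : Fin n → B) :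
    IsQMatrix (q : ℂ) fun i j => if i = j then d i else 0 where
  col i j k hij := by
    by_cases h : i = k
    · subst h; simp [hij.ne']
    · simp [h]
  row i j k hij := by
    by_cases h : k = i
    · subst h; simp [hij.ne]
    · simp [h]
  comm i j k l hij hkl := mul_comm _ _
  cross i j k l hij hkl := by
    by_cases h : j = k
    · have : i ≠ l := (hij.trans_le (h.le.trans hkl.le)).ne
      simp [this, mul_comm]
    · simp [h, mul_comm]

theorem det_diagonal {B : Type*} [CommRing B] [Algebra ℂ B] (d : Fin n → B) :
    det (q : ℂ) (fun i j => if i = j then d i else 0) = ∏ i, d i := by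
  rw [det, Finset.sum_eq_single 1]
  · simp [inv_id, List.prod_ofFn]
  · intro σ _ hσ
    obtain ⟨k, hk⟩ : ∃ k, k ≠ σ k := by
      by_contra! h
      exact hσ (Equiv.ext fun k => (h k).symm)
    rw [List.prod_ofFn, Finset.prod_eq_zero (Finset.mem_univ k), smul_zero]
    simp [hk]
  · simp

variable (n q) in
/-- The counit of `A(SU_q(n))`. -/
def counitHom : SUq n q →ₐ[ℂ] ℂ :=
  lift (fun i j => if i = j then 1 else 0) (isQMatrix_diagonal fun _ => 1) (by
    rw [det_diagonal fun _ => (1 : ℂ)]; simp)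

theorem counitHom_u (i j : Fin n) : counitHom n q (u n q i j) = if i = j then 1 else 0 :=
  lift_u _ _ _ i j

/-- The map `x ↦ x ⊗ 1`. -/
abbrev inl (B : Type*) [Ring B] [Algebra ℂ B] : B →ₐ[ℂ] B ⊗[ℂ] B :=
  Algebra.TensorProduct.includeLeft

/-- The map `x ↦ 1 ⊗ x`. -/
abbrev inr (B : Type*) [Ring B] [Algebra ℂ B] : B →ₐ[ℂ] B ⊗[ℂ] B :=
  Algebra.TensorProduct.includeRight

/-- The coproduct of the matrix `u` is the product of the quantum matrices `u ⊗ 1` and `1 ⊗ u`. -/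
theorem comul_entries (i j : Fin n) : ∑ k, u n q i k ⊗ₜ[ℂ] u n q k j =
    ∑ k, inl _ (u n q i k) * inr _ (u n q k j) := by
  simp

theorem commute_inl_inr {B : Type*} [Ring B] [Algebra ℂ B] (x y : B) :
    Commute (inl B x) (inr B y) := by
  simp [Commute, SemiconjBy]

section

variable [NeZero q]

variable (n q) in
/-- The comultiplication of `A(SU_q(n))`. -/
def comulHom : SUq n q →ₐ[ℂ] SUq n q ⊗[ℂ] SUq n q :=
  lift (fun i j => ∑ k, u n q i k ⊗ₜ[ℂ] u n q k j)
    (by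
      simp only [comul_entries]
      exact ((isQMatrix_u n q).map (inl _)).mul coe_ne_zero_of_neZero
        ((isQMatrix_u n q).map (inr _)) fun _ _ _ _ => commute_inl_inr _ _)
    (by
      simp only [comul_entries]
      rw [det_mul (u := fun i j => inl _ (u n q i j)) (v := fun i j => inr _ (u n q i j))
        coe_ne_zero_of_neZero ((isQMatrix_u n q).map (inr _)) fun _ _ _ _ => commute_inl_inr _ _,
        ← map_det, ← map_det, det_u, map_one, map_one, mul_one])

theorem comulHom_u (i j : Fin n) :
    comulHom n q (u n q i j) = ∑ k, u n q i k ⊗ₜ[ℂ] u n q k j :=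
  lift_u _ _ _ i j

variable (n q) in
/-- The bialgebra structure of `A(SU_q(n))`; its axioms are checked on the generators. -/
scoped instance instBialgebra : Bialgebra ℂ (SUq n q) :=
  Bialgebra.ofAlgHom (comulHom n q) (counitHom n q)
    (algHom_ext fun i j => by
      simp only [AlgHom.comp_apply, comulHom_u, map_sum, Algebra.TensorProduct.map_tmul,
        AlgHom.id_apply, TensorProduct.sum_tmul, TensorProduct.tmul_sum, AlgEquiv.coe_toAlgHom,
        Algebra.TensorProduct.assoc_tmul]
      exact Finset.sum_comm)
    (algHom_ext fun i j => by
      simp [comulHom_u, counitHom_u, TensorProduct.ite_tmul])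
    (algHom_ext fun i j => by
      simp [comulHom_u, counitHom_u, TensorProduct.tmul_ite])

theorem comul_eq (x : SUq n q) : Coalgebra.comul (R := ℂ) x = comulHom n q x := rfl

theorem counit_eq (x : SUq n q) : Coalgebra.counit (R := ℂ) x = counitHom n q x := rfl

/-! ### The antipode -/

variable (n q) in
/-- The antipode of `A(SU_q(n))`, as a homomorphism to the opposite algebra. -/
def antipodeHom : SUq n q →ₐ[ℂ] (SUq n q)ᵐᵒᵖ :=
  lift (fun i j => MulOpposite.op (cof (q : ℂ) (u n q) j i))
    ((isQMatrix_u n q).op_inv coe_ne_zero_of_neZero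
      (fun i j => by rw [sum_mul_cof (isQMatrix_u n q) coe_ne_zero_of_neZero, det_u])
      (fun i j => by simp only [sum_cof_mul (isQMatrix_u n q) (NeZero.ne q), det_u, eq_comm]))
    (det_op_inv coe_ne_zero_of_neZero (isQMatrix_u n q)
      (fun i j => by simp only [sum_cof_mul (isQMatrix_u n q) (NeZero.ne q), det_u, eq_comm])
      (det_u n q))

theorem antipodeHom_u (i j : Fin n) :
    antipodeHom n q (u n q i j) = MulOpposite.op (cof (q : ℂ) (u n q) j i) :=
  lift_u _ _ _ i j

variable (n q) in
/-- The antipode of `A(SU_q(n))`. -/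
def antipodeLin : SUq n q →ₗ[ℂ] SUq n q :=
  (MulOpposite.opLinearEquiv ℂ).symm.toLinearMap ∘ₗ (antipodeHom n q).toLinearMap

theorem antipodeLin_u (i j : Fin n) : antipodeLin n q (u n q i j) = cof (q : ℂ) (u n q) j i := by
  simp [antipodeLin, antipodeHom_u]

theorem antipodeLin_mul (x y : SUq n q) :
    antipodeLin n q (x * y) = antipodeLin n q y * antipodeLin n q x := by
  simp [antipodeLin]

theorem antipodeLin_algebraMap (c : ℂ) :
    antipodeLin n q (algebraMap ℂ _ c) = algebraMap ℂ _ c := by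
  simp [antipodeLin]

theorem antipodeLin_one : antipodeLin n q 1 = 1 := by
  simp [antipodeLin]

/-- The antipode axiom holds for a product `x * y` if it holds for `x` and `y`, since
`∑ S (x₁ y₁) x₂ y₂ = ∑ S y₁ (∑ S x₁ x₂) y₂` and the inner sum is a scalar. -/
theorem mul_antipodeLin_rTensor (x : SUq n q) :
    LinearMap.mul' ℂ _ ((antipodeLin n q).rTensor _ (comulHom n q x)) =
      algebraMap ℂ _ (counitHom n q x) := by
  induction x using induction with
  | algebraMap c =>
    simp [Algebra.TensorProduct.algebraMap_apply, antipodeLin_algebraMap]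
  | u i j =>
    simp only [comulHom_u, map_sum, LinearMap.rTensor_tmul, LinearMap.mul'_apply, antipodeLin_u,
      sum_cof_mul (isQMatrix_u n q) (NeZero.ne q), det_u, counitHom_u, eq_comm (a := j)]
    split_ifs <;> simp
  | add x y hx hy => simp only [map_add, hx, hy]
  | mul x y hx hy =>
    have key : ∀ t s : SUq n q ⊗[ℂ] SUq n q, ∀ c : ℂ,
        LinearMap.mul' ℂ _ ((antipodeLin n q).rTensor _ t) = algebraMap ℂ _ c →
        LinearMap.mul' ℂ _ ((antipodeLin n q).rTensor _ (t * s)) =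
          c • LinearMap.mul' ℂ _ ((antipodeLin n q).rTensor _ s) := by
      intro t s c h
      induction s with
      | zero => simp
      | add s s' hs hs' => simp only [mul_add, map_add, hs, hs', smul_add]
      | tmul a b =>
        have : ∀ t : SUq n q ⊗[ℂ] SUq n q,
            LinearMap.mul' ℂ _ ((antipodeLin n q).rTensor _ (t * a ⊗ₜ b)) =
            antipodeLin n q a * LinearMap.mul' ℂ _ ((antipodeLin n q).rTensor _ t) * b := by
          intro t
          induction t with
          | zero => simp
          | add t t' ht ht' => simp only [add_mul, mul_add, map_add, ht, ht']
          | tmul c d => simp [antipodeLin_mul, mul_assoc]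
        rw [this, h, ← Algebra.commutes, mul_assoc, Algebra.smul_def]
        simp
    rw [map_mul, key _ _ _ hx, hy, map_mul, map_mul, Algebra.smul_def]

theorem mul_antipodeLin_lTensor (x : SUq n q) :
    LinearMap.mul' ℂ _ ((antipodeLin n q).lTensor _ (comulHom n q x)) =
      algebraMap ℂ _ (counitHom n q x) := by
  induction x using induction with
  | algebraMap c =>
    simp [Algebra.TensorProduct.algebraMap_apply, antipodeLin_one]
  | u i j =>
    simp only [comulHom_u, map_sum, LinearMap.lTensor_tmul, LinearMap.mul'_apply, antipodeLin_u,
      sum_mul_cof (isQMatrix_u n q) coe_ne_zero_of_neZero, det_u, counitHom_u]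
    split_ifs <;> simp
  | add x y hx hy => simp only [map_add, hx, hy]
  | mul x y hx hy =>
    have key : ∀ t s : SUq n q ⊗[ℂ] SUq n q, ∀ c : ℂ,
        LinearMap.mul' ℂ _ ((antipodeLin n q).lTensor _ s) = algebraMap ℂ _ c →
        LinearMap.mul' ℂ _ ((antipodeLin n q).lTensor _ (t * s)) =
          c • LinearMap.mul' ℂ _ ((antipodeLin n q).lTensor _ t) := by
      intro t s c h
      induction t with
      | zero => simp
      | add s s' hs hs' => simp only [add_mul, map_add, hs, hs', smul_add]
      | tmul a b =>
        have : ∀ t : SUq n q ⊗[ℂ] SUq n q,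
            LinearMap.mul' ℂ _ ((antipodeLin n q).lTensor _ (a ⊗ₜ b * t)) =
            a * LinearMap.mul' ℂ _ ((antipodeLin n q).lTensor _ t) * antipodeLin n q b := by
          intro t
          induction t with
          | zero => simp
          | add t t' ht ht' => simp only [add_mul, mul_add, map_add, ht, ht']
          | tmul c d => simp [antipodeLin_mul, mul_assoc]
        rw [this, h, ← Algebra.commutes, mul_assoc, Algebra.smul_def]
        simp
    rw [map_mul, key _ _ _ hy, hx, map_mul, Algebra.smul_def, ← map_mul, mul_comm]

variable (n q) in
/-- The Hopf algebra structure of `A(SU_q(n))`. -/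
scoped instance instHopfAlgebra : HopfAlgebra ℂ (SUq n q) where
  antipode := antipodeLin n q
  mul_antipode_rTensor_comul := LinearMap.ext mul_antipodeLin_rTensor
  mul_antipode_lTensor_comul := LinearMap.ext mul_antipodeLin_lTensor

theorem antipode_eq (x : SUq n q) : HopfAlgebra.antipode ℂ x = antipodeLin n q x := rfl

end

end SUq

namespace SUq

open QMatrix

/-! ### The involution -/

variable {n : ℕ} {q : ℝ}

/-- The conjugate-linear ring endomorphism of the free algebra which fixes the generators. It is
defined through the monoid algebra of the free monoid, as the universal property of the free algebra
provides complex linear maps only. -/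
def freeConj (n : ℕ) : Free n →+* Free n :=
  ((FreeAlgebra.equivMonoidAlgebraFreeMonoid (R := ℂ) (X := Fin n × Fin n)).symm :
    MonoidAlgebra ℂ (FreeMonoid (Fin n × Fin n)) →+* Free n).comp
    ((MonoidAlgebra.mapRingHom _ (starRingEnd ℂ)).comp
      (FreeAlgebra.equivMonoidAlgebraFreeMonoid (R := ℂ) (X := Fin n × Fin n) :
        Free n →+* MonoidAlgebra ℂ (FreeMonoid (Fin n × Fin n))))

theorem freeConj_gen (i j : Fin n) : freeConj n (gen i j) = gen i j := by
  simp [freeConj, gen, FreeAlgebra.equivMonoidAlgebraFreeMonoid, MonoidAlgebra.of_apply]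

theorem freeConj_algebraMap (c : ℂ) :
    freeConj n (algebraMap ℂ _ c) = algebraMap ℂ _ (conj c) := by
  rw [Algebra.algebraMap_eq_smul_one (conj c)]
  simp [freeConj, FreeAlgebra.equivMonoidAlgebraFreeMonoid]

theorem freeConj_smul (c : ℂ) (x : Free n) : freeConj n (c • x) = conj c • freeConj n x := by
  rw [Algebra.smul_def, map_mul, freeConj_algebraMap, Algebra.smul_def]

variable (n q) in
/-- The conjugate-linear ring endomorphism of `A(SU_q(n))` which fixes the generators. It exists
since the coefficients of the relations are real. -/
def conjHom : SUq n q →+* SUq n q :=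
  RingQuot.lift ⟨(mk n q).comp (freeConj n), by
    intro x y h
    have hr : mk n q x = mk n q y := RingQuot.mkRingHom_rel h
    suffices freeConj n x = x ∧ freeConj n y = y by
      rw [RingHom.comp_apply, RingHom.comp_apply, this.1, this.2, hr]
    cases h with
    | det => simp [qdet, freeConj_smul, map_list_prod, Function.comp_def, freeConj_gen]
    | _ => simp only [map_mul, map_sub, freeConj_smul, freeConj_gen, map_inv₀, Complex.conj_ofReal,
        and_self]⟩

theorem conjHom_mk (x : Free n) : conjHom n q (mk n q x) = mk n q (freeConj n x) :=
  RingQuot.lift_mkRingHom_apply _ _ _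

theorem conjHom_u (i j : Fin n) : conjHom n q (u n q i j) = u n q i j := by
  rw [u, conjHom_mk, freeConj_gen]

theorem algebraMap_eq_mk (c : ℂ) :
    algebraMap ℂ (SUq n q) c = mk n q (algebraMap ℂ (Free n) c) := by
  rw [← mkAlg_apply, AlgHom.commutes]

theorem conjHom_algebraMap (c : ℂ) :
    conjHom n q (algebraMap ℂ _ c) = algebraMap ℂ _ (conj c) := by
  rw [algebraMap_eq_mk, conjHom_mk, freeConj_algebraMap, algebraMap_eq_mk]

variable [NeZero q]

variable (n q) in
/-- The automorphism of `A(SU_q(n))` which transposes the matrix of generators. -/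
def transposeHom : SUq n q →ₐ[ℂ] SUq n q :=
  lift (fun i j => u n q j i) (isQMatrix_u n q).transpose
    (by rw [det_transpose (isQMatrix_u n q) (NeZero.ne q), det_u])

theorem transposeHom_u (i j : Fin n) : transposeHom n q (u n q i j) = u n q j i :=
  lift_u _ _ _ i j

variable (n q) in
/-- The involution of `A(SU_q(n))`, as a homomorphism to the opposite ring. -/
def starHom : SUq n q →+* (SUq n q)ᵐᵒᵖ :=
  ((antipodeHom n q).comp (transposeHom n q) : SUq n q →+* (SUq n q)ᵐᵒᵖ).comp (conjHom n q)

theorem starHom_u (i j : Fin n) :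
    starHom n q (u n q i j) = MulOpposite.op (cof (q : ℂ) (u n q) i j) := by
  simp [starHom, conjHom_u, transposeHom_u, antipodeHom_u]

theorem starHom_algebraMap (c : ℂ) :
    starHom n q (algebraMap ℂ _ c) = algebraMap ℂ _ (conj c) := by
  simp [starHom, conjHom_algebraMap]

/-- The involution of `A(SU_q(n))`. -/
scoped instance instStar : Star (SUq n q) := ⟨fun x => (starHom n q x).unop⟩

theorem star_eq (x : SUq n q) : star x = (starHom n q x).unop := rfl

theorem star_u_eq_cof (i j : Fin n) : star (u n q i j) = cof (q : ℂ) (u n q) i j := by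
  rw [star_eq, starHom_u, MulOpposite.unop_op]

theorem star_algebraMap' (c : ℂ) : star (algebraMap ℂ (SUq n q) c) = algebraMap ℂ _ (conj c) := by
  rw [star_eq, starHom_algebraMap]
  rfl

theorem star_mul' (x y : SUq n q) : star (x * y) = star y * star x := by
  simp [star_eq]

theorem star_add' (x y : SUq n q) : star (x + y) = star x + star y := by
  simp [star_eq]

/-- The matrix of the `u i j`. -/
def uMatrix (n : ℕ) (q : ℝ) : Matrix (Fin n) (Fin n) (SUq n q) := Matrix.of (u n q)

/-- The matrix of the `S (u i j)`. -/
def sMatrix (n : ℕ) (q : ℝ) : Matrix (Fin n) (Fin n) (SUq n q) :=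
  Matrix.of fun i j => cof (q : ℂ) (u n q) j i

theorem uMatrix_mul_sMatrix : uMatrix n q * sMatrix n q = 1 := by
  ext i j
  simp [uMatrix, sMatrix, Matrix.mul_apply, Matrix.one_apply, det_u,
    sum_mul_cof (isQMatrix_u n q) coe_ne_zero_of_neZero]

theorem sMatrix_mul_uMatrix : sMatrix n q * uMatrix n q = 1 := by
  ext i j
  simp [uMatrix, sMatrix, Matrix.mul_apply, Matrix.one_apply, det_u,
    sum_cof_mul (isQMatrix_u n q) (NeZero.ne q), eq_comm (a := j)]

/-- The involution maps the cofactors back to the generators: both `u` and the matrix of the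
`star (star (u i j))` are inverse to the matrix of the `S (u i j)`. -/
theorem star_cof (i j : Fin n) : star (cof (q : ℂ) (u n q) i j) = u n q i j := by
  let X : Matrix (Fin n) (Fin n) (SUq n q) :=
    Matrix.of fun i j => star (cof (q : ℂ) (u n q) i j)
  have h : X * sMatrix n q = 1 := by
    ext i j
    -- apply the involution to `u * S(u) = 1`
    have h := congrArg (starHom n q) (sum_mul_cof (isQMatrix_u n q) coe_ne_zero_of_neZero i j)
    rw [map_sum, det_u] at h
    have h' := congrArg MulOpposite.unop h
    simp only [map_mul, Finset.unop_sum, MulOpposite.unop_mul, ← star_eq, star_u_eq_cof] at h'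
    simp only [X, sMatrix, Matrix.mul_apply, Matrix.of_apply, h', Matrix.one_apply,
      eq_comm (a := j)]
    split_ifs <;> simp [star_eq]
  exact congrArg (fun M : Matrix _ _ _ => M i j) (left_inv_eq_right_inv h sMatrix_mul_uMatrix)

/-- The involution makes `A(SU_q(n))` a `∗`-ring. -/
scoped instance instStarRing : StarRing (SUq n q) where
  star_involutive x := by
    induction x using induction with
    | algebraMap c => rw [star_algebraMap', star_algebraMap', Complex.conj_conj]
    | u i j => rw [star_u_eq_cof, star_cof]
    | add x y hx hy => rw [star_add', star_add', hx, hy]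
    | mul x y hx hy => rw [star_mul', star_mul', hx, hy]
  star_mul := star_mul'
  star_add := star_add'

/-- The involution is conjugate-linear. -/
scoped instance instStarModule : StarModule ℂ (SUq n q) where
  star_smul c x := by
    rw [Algebra.smul_def, star_mul, star_algebraMap', ← Algebra.commutes, Algebra.smul_def]
    rfl

theorem star_tensor_mul {B : Type*} [Ring B] [Algebra ℂ B] [StarRing B] [StarModule ℂ B]
    (t s : B ⊗[ℂ] B) : star (t * s) = star s * star t := by
  induction t with
  | zero => simp
  | add t t' h h' => rw [add_mul, star_add, h, h', star_add, mul_add]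
  | tmul a b =>
    induction s with
    | zero => simp
    | add s s' h h' => rw [mul_add, star_add, h, h', star_add, add_mul]
    | tmul c d => simp

/-- The antipode reverses the coproduct of the generators, as both `∑ S (u k j) ⊗ S (u i k)` and
`Δ (S (u i j))` form the inverse of the matrix of the `Δ (u i j)`. -/
theorem comulHom_cof (i j : Fin n) : comulHom n q (cof (q : ℂ) (u n q) i j) =
    ∑ k, cof (q : ℂ) (u n q) i k ⊗ₜ[ℂ] cof (q : ℂ) (u n q) k j := by
  have h1 : (sMatrix n q).map (comulHom n q) * (uMatrix n q).map (comulHom n q) = 1 := by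
    rw [← Matrix.map_mul, sMatrix_mul_uMatrix, Matrix.map_one _ (map_zero _) (map_one _)]
  have h2 : (uMatrix n q).map (comulHom n q) =
      (uMatrix n q).map (inl _) * (uMatrix n q).map (inr _) := by
    ext i j
    simp [uMatrix, Matrix.mul_apply, comulHom_u]
  have h3 : (uMatrix n q).map (comulHom n q) *
      ((sMatrix n q).map (inr _) * (sMatrix n q).map (inl _)) = 1 := by
    rw [h2, mul_assoc, ← mul_assoc ((uMatrix n q).map (inr _)), ← Matrix.map_mul,
      uMatrix_mul_sMatrix, Matrix.map_one _ (map_zero _) (map_one _), one_mul, ← Matrix.map_mul,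
      uMatrix_mul_sMatrix, Matrix.map_one _ (map_zero _) (map_one _)]
  have h4 := congrArg (fun M : Matrix _ _ _ => M j i) (left_inv_eq_right_inv h1 h3)
  simpa [sMatrix, Matrix.mul_apply] using h4

theorem counitHom_cof (i j : Fin n) :
    counitHom n q (cof (q : ℂ) (u n q) i j) = if i = j then 1 else 0 := by
  have h1 : (sMatrix n q).map (counitHom n q) * (uMatrix n q).map (counitHom n q) = 1 := by
    rw [← Matrix.map_mul, sMatrix_mul_uMatrix, Matrix.map_one _ (map_zero _) (map_one _)]
  have h2 : (uMatrix n q).map (counitHom n q) = 1 := by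
    ext i j
    simp [uMatrix, counitHom_u, Matrix.one_apply]
  rw [h2, mul_one] at h1
  have h4 := congrFun (congrFun h1 j) i
  simpa [sMatrix, Matrix.one_apply, eq_comm (a := j)] using h4

theorem isStandardHopfStar : IsStandardHopfStar n q where
  algebraMap_eq := algebraMap_eq_mk
  comul_u := comulHom_u
  counit_u := counitHom_u
  antipode_u i j := by rw [antipode_eq, antipodeLin_u, star_u_eq_cof]
  star_u i j := by rw [star_u_eq_cof, mk_cofactor]
  comul_star x := by
    simp only [comul_eq]
    induction x using induction with
    | algebraMap c =>
      simp only [star_algebraMap', AlgHom.commutes, Algebra.TensorProduct.algebraMap_apply,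
        TensorProduct.star_tmul, star_one]
    | u i j =>
      rw [star_u_eq_cof, comulHom_cof, comulHom_u, star_sum]
      simp only [TensorProduct.star_tmul, star_u_eq_cof]
    | add x y hx hy => rw [star_add, map_add, hx, hy, map_add, star_add]
    | mul x y hx hy => rw [star_mul, map_mul, hx, hy, map_mul, star_tensor_mul]
  counit_star x := by
    simp only [counit_eq]
    induction x using induction with
    | algebraMap c => simp only [star_algebraMap', AlgHom.commutes]; rfl
    | u i j => rw [star_u_eq_cof, counitHom_cof, counitHom_u]; split_ifs <;> simp
    | add x y hx hy => rw [star_add, map_add, hx, hy, map_add, map_add]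
    | mul x y hx hy => rw [star_mul, map_mul, hx, hy, map_mul, map_mul, mul_comm]

end SUq

/-! ### The involution of the Laurent polynomials -/

namespace HopfTwist

theorem laurentStar_add (f g : ℂ[T;T⁻¹]) : laurentStar (f + g) = laurentStar f + laurentStar g := by
  simp only [laurentStar, AddMonoidAlgebra.coeff_add]
  exact Finsupp.sum_add_index' (by simp) fun _ _ _ => by simp [add_mul]

theorem laurentStar_C_mul_T (c : ℂ) (k : ℤ) :
    laurentStar (LaurentPolynomial.C c * LaurentPolynomial.T k) =
      LaurentPolynomial.C (conj c) * LaurentPolynomial.T (-k) := by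
  rw [laurentStar, ← LaurentPolynomial.single_eq_C_mul_T, AddMonoidAlgebra.coeff_single,
    Finsupp.sum_single_index (by simp)]

theorem laurentStar_mul (f g : ℂ[T;T⁻¹]) : laurentStar (f * g) = laurentStar f * laurentStar g := by
  induction f using LaurentPolynomial.induction_on' with
  | add f f' h h' => rw [add_mul, laurentStar_add, h, h', laurentStar_add, add_mul]
  | C_mul_T k c =>
    induction g using LaurentPolynomial.induction_on' with
    | add g g' h h' => rw [mul_add, laurentStar_add, h, h', laurentStar_add, mul_add]
    | C_mul_T l d =>
      have h : ∀ (a b : ℂ) (r s : ℤ),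
          LaurentPolynomial.C a * LaurentPolynomial.T r *
            (LaurentPolynomial.C b * LaurentPolynomial.T s) =
          LaurentPolynomial.C (a * b) * LaurentPolynomial.T (r + s) := fun a b r s => by
        rw [map_mul, LaurentPolynomial.T_add]
        ring
      rw [h, laurentStar_C_mul_T, laurentStar_C_mul_T, laurentStar_C_mul_T, h,
        map_mul (starRingEnd ℂ), neg_add]

theorem laurentStar_T (k : ℤ) :
    laurentStar (LaurentPolynomial.T k) = LaurentPolynomial.T (-k) := by
  simpa using laurentStar_C_mul_T 1 k

theorem laurentStar_algebraMap (c : ℂ) :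
    laurentStar (algebraMap ℂ _ c) = algebraMap ℂ _ (conj c) := by
  simpa using laurentStar_C_mul_T c 0

end HopfTwist

namespace SUq

open QMatrix

/-! ### The map to the Laurent polynomials -/

variable {n : ℕ} {q : ℝ} (p : Fin n → ℤ) (hp : ∑ k, p k = 0)

theorem prod_T {ι : Type*} (s : Finset ι) (d : ι → ℤ) :
    ∏ i ∈ s, (LaurentPolynomial.T (d i) : ℂ[T;T⁻¹]) = LaurentPolynomial.T (∑ i ∈ s, d i) := by
  classical
  induction s using Finset.induction_on with
  | empty => simp
  | insert a s ha ih => rw [Finset.prod_insert ha, Finset.sum_insert ha, ih, LaurentPolynomial.T_add]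

variable (q) in
/-- The algebra homomorphism `u i j ↦ δ_{ij} z ^ p i`. -/
def torusAlgHom : SUq n q →ₐ[ℂ] ℂ[T;T⁻¹] :=
  lift (fun i j => if i = j then LaurentPolynomial.T (p i) else 0)
    (isQMatrix_diagonal fun i => LaurentPolynomial.T (p i))
    (by rw [det_diagonal fun i => LaurentPolynomial.T (p i), prod_T, hp, LaurentPolynomial.T_zero])

theorem torusAlgHom_u (i j : Fin n) :
    torusAlgHom q p hp (u n q i j) = if i = j then LaurentPolynomial.T (p i) else 0 :=
  lift_u _ _ _ i j

variable [NeZero q]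

variable (q) in
/-- The bialgebra homomorphism `u i j ↦ δ_{ij} z ^ p i`. -/
def torusHom : SUq n q →ₐc[ℂ] ℂ[T;T⁻¹] :=
  BialgHom.ofAlgHom (torusAlgHom q p hp)
    (algHom_ext fun i j => by
      simp only [AlgHom.comp_apply, torusAlgHom_u, Bialgebra.counitAlgHom_apply, counit_eq,
        counitHom_u]
      split_ifs <;> simp)
    (algHom_ext fun i j => by
      simp only [AlgHom.comp_apply, torusAlgHom_u, Bialgebra.comulAlgHom_apply, comul_eq,
        comulHom_u, map_sum, Algebra.TensorProduct.map_tmul]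
      by_cases h : i = j
      · subst h
        simp [TensorProduct.ite_tmul]
      · simp [TensorProduct.ite_tmul, h])

theorem torusHom_apply (x : SUq n q) : torusHom q p hp x = torusAlgHom q p hp x := rfl

theorem torusHom_u (i j : Fin n) :
    torusHom q p hp (u n q i j) = if i = j then LaurentPolynomial.T (p i) else 0 :=
  torusAlgHom_u p hp i j

/-- The image of the cofactor matrix is the inverse of the image of `u`, which is diagonal. -/
theorem torusAlgHom_cof (i j : Fin n) :
    torusAlgHom q p hp (cof (q : ℂ) (u n q) i j) =
      if i = j then LaurentPolynomial.T (-p i) else 0 := by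
  have h1 : (sMatrix n q).map (torusAlgHom q p hp) * (uMatrix n q).map (torusAlgHom q p hp) = 1 := by
    rw [← Matrix.map_mul, sMatrix_mul_uMatrix, Matrix.map_one _ (map_zero _) (map_one _)]
  have h2 : (uMatrix n q).map (torusAlgHom q p hp) =
      Matrix.diagonal fun i => LaurentPolynomial.T (p i) := by
    ext1 i j
    simp [uMatrix, torusAlgHom_u, Matrix.diagonal_apply]
  have h3 : (Matrix.diagonal fun i => (LaurentPolynomial.T (p i) : ℂ[T;T⁻¹])) *
      (Matrix.diagonal fun i => LaurentPolynomial.T (-p i)) = 1 := by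
    simp only [Matrix.diagonal_mul_diagonal, ← LaurentPolynomial.T_add, add_neg_cancel,
      LaurentPolynomial.T_zero, Matrix.diagonal_one]
  rw [h2] at h1
  have h4 := congrArg (fun M : Matrix _ _ _ => M j i) (left_inv_eq_right_inv h1 h3)
  simp only [sMatrix, Matrix.map_apply, Matrix.of_apply, Matrix.diagonal_apply] at h4
  rw [h4]
  by_cases h : i = j
  · simp [h]
  · simp [h, Ne.symm h]

theorem torusHom_antipode (x : SUq n q) : torusHom q p hp (HopfAlgebra.antipode ℂ x) =
    HopfAlgebra.antipode ℂ (torusHom q p hp x) := by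
  simp only [torusHom_apply, antipode_eq]
  induction x using induction with
  | algebraMap c =>
    rw [antipodeLin_algebraMap, AlgHom.commutes, Algebra.algebraMap_eq_smul_one, map_smul,
      HopfAlgebra.antipode_one]
  | u i j =>
    rw [antipodeLin_u, torusAlgHom_cof, torusAlgHom_u]
    by_cases h : i = j
    · simp [h]
    · simp [h, Ne.symm h]
  | add x y hx hy => simp only [map_add, hx, hy]
  | mul x y hx hy =>
    rw [antipodeLin_mul, map_mul, hx, hy, map_mul, HopfAlgebra.antipode_mul_antidistrib]

theorem torusHom_star (x : SUq n q) :
    torusHom q p hp (star x) = HopfTwist.laurentStar (torusHom q p hp x) := by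
  simp only [torusHom_apply]
  induction x using induction with
  | algebraMap c =>
    rw [star_algebraMap', AlgHom.commutes, AlgHom.commutes, HopfTwist.laurentStar_algebraMap]
  | u i j =>
    rw [star_u_eq_cof, torusAlgHom_cof, torusAlgHom_u]
    split_ifs
    · rw [HopfTwist.laurentStar_T]
    · simp [HopfTwist.laurentStar]
  | add x y hx hy => rw [star_add, map_add, hx, hy, map_add, HopfTwist.laurentStar_add]
  | mul x y hx hy => rw [star_mul, map_mul, hx, hy, map_mul, HopfTwist.laurentStar_mul, mul_comm]

end SUq

namespace HopfTwist

/-! ### Homogeneous elements -/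

variable {H : Type*} [Ring H] [HopfAlgebra ℂ H] {α : H →ₐc[ℂ] ℂ[T;T⁻¹]}

theorem leftCoaction_mul (x y : H) :
    leftCoaction α (x * y) = leftCoaction α x * leftCoaction α y := by
  have h : ∀ x, leftCoaction α x = Algebra.TensorProduct.map (α : H →ₐ[ℂ] ℂ[T;T⁻¹])
    (AlgHom.id ℂ H) (Bialgebra.comulAlgHom ℂ H x) := fun _ => rfl
  simp only [h, map_mul]

theorem rightCoaction_mul (x y : H) :
    rightCoaction α (x * y) = rightCoaction α x * rightCoaction α y := by
  have h : ∀ x, rightCoaction α x = Algebra.TensorProduct.map (AlgHom.id ℂ H)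
    (α : H →ₐ[ℂ] ℂ[T;T⁻¹]) (Bialgebra.comulAlgHom ℂ H x) := fun _ => rfl
  simp only [h, map_mul]

variable (α) in
theorem IsHomogeneous.one : IsHomogeneous α 0 0 (1 : H) := by
  simp [IsHomogeneous, leftCoaction, rightCoaction, Algebra.TensorProduct.one_def]

theorem IsHomogeneous.mul {μ ν μ' ν' : ℤ} {x y : H} (hx : IsHomogeneous α μ ν x)
    (hy : IsHomogeneous α μ' ν' y) : IsHomogeneous α (μ + μ') (ν + ν') (x * y) := by
  rw [IsHomogeneous, leftCoaction_mul, rightCoaction_mul, hx.1, hx.2, hy.1, hy.2]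
  simp only [Algebra.TensorProduct.tmul_mul_tmul, ← LaurentPolynomial.T_add, and_self]

variable (α) in
/-- The homogeneous elements of given degrees, as a subspace. -/
def homogeneousSubmodule (μ ν : ℤ) : Submodule ℂ H where
  carrier := {x | IsHomogeneous α μ ν x}
  zero_mem' := by simp [IsHomogeneous]
  add_mem' {x y} hx hy := by
    change IsHomogeneous α μ ν (x + y)
    rw [IsHomogeneous, map_add, map_add, hx.1, hx.2, hy.1, hy.2, TensorProduct.tmul_add,
      TensorProduct.add_tmul]
    exact ⟨rfl, rfl⟩
  smul_mem' c x hx := by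
    change IsHomogeneous α μ ν (c • x)
    rw [IsHomogeneous, map_smul, map_smul, hx.1, hx.2, TensorProduct.tmul_smul,
      TensorProduct.smul_tmul']
    exact ⟨rfl, rfl⟩

/-- The image of a homogeneous element is a multiple of both `z ^ μ` and `z ^ ν`, with the counit
as the coefficient. -/
theorem IsHomogeneous.apply_eq {μ ν : ℤ} {x : H} (hx : IsHomogeneous α μ ν x) :
    α x = Coalgebra.counit (R := ℂ) x • LaurentPolynomial.T μ ∧
      α x = Coalgebra.counit (R := ℂ) x • LaurentPolynomial.T ν := by
  constructor
  · have h : ∀ t : H ⊗[ℂ] H, TensorProduct.rid ℂ _ ((Coalgebra.counit (R := ℂ)).lTensor _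
        ((α : H →ₗ[ℂ] ℂ[T;T⁻¹]).rTensor H t)) =
        (α : H →ₗ[ℂ] ℂ[T;T⁻¹]) (TensorProduct.rid ℂ _ ((Coalgebra.counit (R := ℂ)).lTensor _ t)) := by
      intro t
      induction t with
      | zero => simp
      | tmul a b => simp
      | add t t' h h' => simp only [map_add, h, h']
    have h1 := h (Coalgebra.comul x)
    rw [Coalgebra.lTensor_counit_comul] at h1
    have h2 := hx.1
    rw [leftCoaction, LinearMap.comp_apply] at h2
    rw [h2] at h1
    simpa using h1.symm
  · have h : ∀ t : H ⊗[ℂ] H, TensorProduct.lid ℂ _ ((Coalgebra.counit (R := ℂ)).rTensor _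
        ((α : H →ₗ[ℂ] ℂ[T;T⁻¹]).lTensor H t)) =
        (α : H →ₗ[ℂ] ℂ[T;T⁻¹]) (TensorProduct.lid ℂ _ ((Coalgebra.counit (R := ℂ)).rTensor _ t)) := by
      intro t
      induction t with
      | zero => simp
      | tmul a b => simp
      | add t t' h h' => simp only [map_add, h, h']
    have h1 := h (Coalgebra.comul x)
    rw [Coalgebra.rTensor_counit_comul] at h1
    have h2 := hx.2
    rw [rightCoaction, LinearMap.comp_apply] at h2
    rw [h2] at h1
    simpa using h1.symm

/-- The counit vanishes on homogeneous elements with different left and right degree. -/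
theorem IsHomogeneous.eq_or_counit_eq_zero {μ ν : ℤ} {x : H} (hx : IsHomogeneous α μ ν x) :
    μ = ν ∨ Coalgebra.counit (R := ℂ) x = 0 := by
  by_contra! h
  have h1 := hx.apply_eq.1.symm.trans hx.apply_eq.2
  have h2 : (LaurentPolynomial.T μ : ℂ[T;T⁻¹]) = LaurentPolynomial.T ν :=
    smul_right_injective _ h.2 h1
  have h3 : Finsupp.single μ (1 : ℂ) μ = Finsupp.single ν (1 : ℂ) μ :=
    congrArg (fun f : ℂ[T;T⁻¹] => f.coeff μ) h2
  simp [h.1.symm] at h3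

theorem phase_add (s t : ℝ) : phase (s + t) = phase s * phase t := by
  simp [phase, mul_add, Complex.exp_add]

theorem phase_zero : phase 0 = 1 := by simp [phase]

/-! ### Homogeneous subspaces -/

/-- The span of the `a ⊗ b` with `a` of degrees `μ, κ` and `b` of degrees `κ, ν`, for some `κ`. -/
def balanced {M : Type*} [AddCommGroup M] [Module ℂ M] (G : ℤ → ℤ → Submodule ℂ M) (μ ν : ℤ) :
    Submodule ℂ (M ⊗[ℂ] M) :=
  Submodule.span ℂ {t | ∃ κ, ∃ a ∈ G μ κ, ∃ b ∈ G κ ν, a ⊗ₜ[ℂ] b = t}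

variable (α) in
/-- Spaces `G μ ν` of homogeneous elements that span `H`, contain the unit and are compatible with
the product, the coproduct and the antipode. -/
structure IsBigrading (G : ℤ → ℤ → Submodule ℂ H) : Prop where
  isHomogeneous : ∀ {μ ν x}, x ∈ G μ ν → IsHomogeneous α μ ν x
  one_mem : 1 ∈ G 0 0
  mul_mem : ∀ {μ ν μ' ν' x y}, x ∈ G μ ν → y ∈ G μ' ν' → x * y ∈ G (μ + μ') (ν + ν')
  comul_mem : ∀ {μ ν x}, x ∈ G μ ν → Coalgebra.comul x ∈ balanced G μ ν
  antipode_mem : ∀ {μ ν x}, x ∈ G μ ν → HopfAlgebra.antipode ℂ x ∈ G (-ν) (-μ)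
  iSup_eq_top : ⨆ d : ℤ × ℤ, G d.1 d.2 = ⊤

namespace IsBigrading

variable {G : ℤ → ℤ → Submodule ℂ H} {N : Type*} [AddCommGroup N] [Module ℂ N]

/-- Identities between linear maps on coproducts of homogeneous elements may be checked on the
terms `a ⊗ b` with matching inner degrees. -/
theorem eqOn_balanced {μ ν : ℤ} {f g : H ⊗[ℂ] H →ₗ[ℂ] N}
    (h : ∀ κ, ∀ a ∈ G μ κ, ∀ b ∈ G κ ν, f (a ⊗ₜ b) = g (a ⊗ₜ b)) {t : H ⊗[ℂ] H}
    (ht : t ∈ balanced G μ ν) : f t = g t := by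
  refine LinearMap.eqOn_span ?_ ht
  rintro _ ⟨κ, a, ha, b, hb, rfl⟩
  exact h κ a ha b hb

variable (hG : IsBigrading α G)
include hG

theorem linearMap_ext {f g : H →ₗ[ℂ] N} (h : ∀ μ ν, ∀ x ∈ G μ ν, f x = g x) : f = g := by
  ext x
  have hx : x ∈ ⨆ d : ℤ × ℤ, G d.1 d.2 := hG.iSup_eq_top ▸ Submodule.mem_top
  induction hx using Submodule.iSup_induction' with
  | mem d x hx => exact h _ _ x hx
  | zero => simp
  | add x y _ _ hx hy => rw [map_add, map_add, hx, hy]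

theorem linearMap_ext₂ {f g : H ⊗[ℂ] H →ₗ[ℂ] N}
    (h : ∀ μ ν, ∀ x ∈ G μ ν, ∀ μ' ν', ∀ y ∈ G μ' ν', f (x ⊗ₜ y) = g (x ⊗ₜ y)) : f = g :=
  TensorProduct.ext <| hG.linearMap_ext fun μ ν x hx => hG.linearMap_ext fun μ' ν' y hy =>
    h μ ν x hx μ' ν' y hy

theorem linearMap_ext₃ {f g : H ⊗[ℂ] (H ⊗[ℂ] H) →ₗ[ℂ] N}
    (h : ∀ μ ν, ∀ x ∈ G μ ν, ∀ μ' ν', ∀ y ∈ G μ' ν', ∀ μ'' ν'', ∀ z ∈ G μ'' ν'',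
      f (x ⊗ₜ (y ⊗ₜ z)) = g (x ⊗ₜ (y ⊗ₜ z))) : f = g :=
  TensorProduct.ext <| hG.linearMap_ext fun μ ν x hx => hG.linearMap_ext₂ fun μ' ν' y hy =>
    h μ ν x hx μ' ν' y hy

end IsBigrading

/-! ### The structure maps of the twist on homogeneous elements -/

variable {φ : ℝ} {μ ν μ' ν' : ℤ} {x y : H}

theorem twistMul_tmul (hx : IsHomogeneous α μ ν x) (hy : IsHomogeneous α μ' ν' y) :
    twistMul α φ (x ⊗ₜ y) = phase (φ * (μ * ν' - ν * μ')) • (x * y) := by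
  rw [twistMul, LinearMap.comp_apply, scaleTensor_tmul α _ hx hy, map_smul, LinearMap.mul'_apply]

theorem twistBraiding_tmul (hx : IsHomogeneous α μ ν x) (hy : IsHomogeneous α μ' ν' y) :
    twistBraiding α φ (x ⊗ₜ y) = phase (2 * φ * ((μ - ν) * (μ' - ν'))) • (y ⊗ₜ[ℂ] x) := by
  rw [twistBraiding, LinearMap.comp_apply, scaleTensor_tmul α _ hx hy, map_smul]
  rfl

theorem twistAntipode_apply (hx : IsHomogeneous α μ ν x) :
    twistAntipode α φ x = phase (φ * (μ - ν) ^ 2) • HopfAlgebra.antipode ℂ x := by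
  rw [twistAntipode, bigradedMap_apply α _ hx]
  rfl

variable (α φ) in
/-- The scaling of `H ⊗ H` by which the twisted coproduct differs from the coproduct. -/
def comulScale : H ⊗[ℂ] H →ₗ[ℂ] H ⊗[ℂ] H :=
  scaleTensor α fun μ ν μ' ν' => phase (φ * ((μ - ν) * (μ' - ν')))

theorem twistComul_apply (x : H) : twistComul α φ x = comulScale α φ (Coalgebra.comul x) := rfl

theorem comulScale_tmul (hx : IsHomogeneous α μ ν x) (hy : IsHomogeneous α μ' ν' y) :
    comulScale α φ (x ⊗ₜ y) = phase (φ * ((μ - ν) * (μ' - ν'))) • (x ⊗ₜ[ℂ] y) :=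
  scaleTensor_tmul α _ hx hy

variable (α φ) in
/-- The scaling of `H ⊗ H ⊗ H` by which the iterated twisted coproduct differs from the iterated
coproduct. -/
def comulScale₃ : H ⊗[ℂ] (H ⊗[ℂ] H) →ₗ[ℂ] H ⊗[ℂ] (H ⊗[ℂ] H) :=
  TensorProduct.lift (bigradedMap (N := H ⊗[ℂ] H →ₗ[ℂ] H ⊗[ℂ] (H ⊗[ℂ] H)) α
    fun μ ν => (TensorProduct.mk ℂ H (H ⊗[ℂ] H)).compl₂ (scaleTensor α fun μ' ν' μ'' ν'' =>
      phase (φ * ((μ - ν) * (μ' - ν') + (μ - ν) * (μ'' - ν'') + (μ' - ν') * (μ'' - ν'')))))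

theorem comulScale₃_tmul {μ'' ν'' : ℤ} {z : H} (hx : IsHomogeneous α μ ν x)
    (hy : IsHomogeneous α μ' ν' y) (hz : IsHomogeneous α μ'' ν'' z) :
    comulScale₃ α φ (x ⊗ₜ (y ⊗ₜ z)) =
      phase (φ * ((μ - ν) * (μ' - ν') + (μ - ν) * (μ'' - ν'') + (μ' - ν') * (μ'' - ν''))) •
        (x ⊗ₜ[ℂ] (y ⊗ₜ[ℂ] z)) := by
  rw [comulScale₃, TensorProduct.lift.tmul, bigradedMap_apply α _ hx, LinearMap.compl₂_apply,
    scaleTensor_tmul α _ hy hz, map_smul]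
  rfl

open BraidedHopf

theorem on12_twistBraiding (hx : IsHomogeneous α μ ν x) (hy : IsHomogeneous α μ' ν' y) (z : H) :
    on12 (twistBraiding α φ) (x ⊗ₜ (y ⊗ₜ z)) =
      phase (2 * φ * ((μ - ν) * (μ' - ν'))) • (y ⊗ₜ[ℂ] (x ⊗ₜ[ℂ] z)) := by
  simp [on12, twistBraiding_tmul hx hy, TensorProduct.smul_tmul']

theorem on23_twistBraiding (z : H) (hx : IsHomogeneous α μ ν x) (hy : IsHomogeneous α μ' ν' y) :
    on23 (twistBraiding α φ) (z ⊗ₜ (x ⊗ₜ y)) =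
      phase (2 * φ * ((μ - ν) * (μ' - ν'))) • (z ⊗ₜ[ℂ] (y ⊗ₜ[ℂ] x)) := by
  simp [on23, twistBraiding_tmul hx hy]

theorem onMiddle_twistBraiding (a b : H) (hx : IsHomogeneous α μ ν x)
    (hy : IsHomogeneous α μ' ν' y) :
    onMiddle (twistBraiding α φ) ((a ⊗ₜ x) ⊗ₜ (y ⊗ₜ b)) =
      phase (2 * φ * ((μ - ν) * (μ' - ν'))) • ((a ⊗ₜ[ℂ] y) ⊗ₜ[ℂ] (x ⊗ₜ[ℂ] b)) := by
  simp [onMiddle, on12_twistBraiding hx hy]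

end HopfTwist

namespace HopfTwist

/-! ### The twist is a braided Hopf algebra -/

open BraidedHopf

theorem phase_smul_congr {N : Type*} [AddCommGroup N] [Module ℂ N] {s t : ℝ} (h : s = t) (x : N) :
    phase s • x = phase t • x := by rw [h]

namespace IsBigrading

variable {H : Type*} [Ring H] [HopfAlgebra ℂ H] {α : H →ₐc[ℂ] ℂ[T;T⁻¹]}
  {G : ℤ → ℤ → Submodule ℂ H} (hG : IsBigrading α G) (φ : ℝ)
include hG

theorem comulScale_mem {μ ν : ℤ} {t : H ⊗[ℂ] H} (ht : t ∈ balanced G μ ν) :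
    comulScale α φ t ∈ balanced G μ ν := by
  suffices balanced G μ ν ≤ (balanced G μ ν).comap (comulScale α φ) from this ht
  refine Submodule.span_le.mpr ?_
  rintro _ ⟨κ, a, ha, b, hb, rfl⟩
  rw [SetLike.mem_coe, Submodule.mem_comap,
    comulScale_tmul (hG.isHomogeneous ha) (hG.isHomogeneous hb)]
  exact Submodule.smul_mem _ _ (Submodule.subset_span ⟨κ, a, ha, b, hb, rfl⟩)

theorem twistComul_mem {μ ν : ℤ} {x : H} (hx : x ∈ G μ ν) : twistComul α φ x ∈ balanced G μ ν :=
  hG.comulScale_mem φ (hG.comul_mem hx)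

theorem twistMul_assoc : twistMul α φ ∘ₗ (twistMul α φ).rTensor H ∘ₗ
      (TensorProduct.assoc ℂ H H H).symm.toLinearMap =
    twistMul α φ ∘ₗ (twistMul α φ).lTensor H := by
  refine hG.linearMap_ext₃ fun μ ν x hx μ' ν' y hy μ'' ν'' z hz => ?_
  simp only [LinearMap.comp_apply, LinearEquiv.coe_coe, TensorProduct.assoc_symm_tmul,
    LinearMap.rTensor_tmul, LinearMap.lTensor_tmul,
    twistMul_tmul (hG.isHomogeneous hx) (hG.isHomogeneous hy),
    twistMul_tmul (hG.isHomogeneous hy) (hG.isHomogeneous hz), ← TensorProduct.smul_tmul',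
    TensorProduct.tmul_smul, map_smul,
    twistMul_tmul (hG.isHomogeneous (hG.mul_mem hx hy)) (hG.isHomogeneous hz),
    twistMul_tmul (hG.isHomogeneous hx) (hG.isHomogeneous (hG.mul_mem hy hz)),
    smul_smul, ← phase_add, mul_assoc]
  refine phase_smul_congr ?_ _
  push_cast
  ring

theorem twistMul_one_left : twistMul α φ ∘ₗ TensorProduct.mk ℂ H H 1 = LinearMap.id := by
  refine hG.linearMap_ext fun μ ν x hx => ?_
  simp [twistMul_tmul (hG.isHomogeneous hG.one_mem) (hG.isHomogeneous hx), phase_zero]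

theorem twistMul_one_right :
    twistMul α φ ∘ₗ (TensorProduct.mk ℂ H H).flip 1 = LinearMap.id := by
  refine hG.linearMap_ext fun μ ν x hx => ?_
  simp [twistMul_tmul (hG.isHomogeneous hx) (hG.isHomogeneous hG.one_mem), phase_zero]

/-- Applying the twisted coproduct to the first factor of a twisted coproduct amounts to scaling the
iterated coproduct by `comulScale₃`. -/
theorem rTensor_twistComul {μ ν : ℤ} {t : H ⊗[ℂ] H} (ht : t ∈ balanced G μ ν) :
    TensorProduct.assoc ℂ H H H ((twistComul α φ).rTensor H (comulScale α φ t)) =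
      comulScale₃ α φ (TensorProduct.assoc ℂ H H H (Coalgebra.comul.rTensor H t)) := by
  refine eqOn_balanced (f := (TensorProduct.assoc ℂ H H H).toLinearMap ∘ₗ
    (twistComul α φ).rTensor H ∘ₗ comulScale α φ) (g := comulScale₃ α φ ∘ₗ
    (TensorProduct.assoc ℂ H H H).toLinearMap ∘ₗ Coalgebra.comul.rTensor H)
    (fun κ a ha b hb => ?_) ht
  simp only [LinearMap.comp_apply, comulScale_tmul (hG.isHomogeneous ha) (hG.isHomogeneous hb),
    map_smul, LinearMap.rTensor_tmul, twistComul_apply, LinearEquiv.coe_coe]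
  refine eqOn_balanced (f := phase (φ * ((μ - κ) * (κ - ν))) •
    ((TensorProduct.assoc ℂ H H H).toLinearMap ∘ₗ (TensorProduct.mk ℂ (H ⊗[ℂ] H) H).flip b ∘ₗ
      comulScale α φ)) (g := comulScale₃ α φ ∘ₗ (TensorProduct.assoc ℂ H H H).toLinearMap ∘ₗ
      (TensorProduct.mk ℂ (H ⊗[ℂ] H) H).flip b) (fun κ' c hc d hd => ?_) (hG.comul_mem ha)
  simp only [LinearMap.smul_apply, LinearMap.comp_apply, LinearMap.flip_apply,
    TensorProduct.mk_apply, LinearEquiv.coe_coe,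
    comulScale_tmul (hG.isHomogeneous hc) (hG.isHomogeneous hd), map_smul,
    TensorProduct.assoc_tmul,
    comulScale₃_tmul (hG.isHomogeneous hc) (hG.isHomogeneous hd) (hG.isHomogeneous hb),
    smul_smul, ← phase_add]
  refine phase_smul_congr ?_ _
  ring

/-- The iterated twisted coproduct on the second factor is scaled by `comulScale₃`, too. -/
theorem lTensor_twistComul {μ ν : ℤ} {t : H ⊗[ℂ] H} (ht : t ∈ balanced G μ ν) :
    (twistComul α φ).lTensor H (comulScale α φ t) =
      comulScale₃ α φ (Coalgebra.comul.lTensor H t) := by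
  refine eqOn_balanced (f := (twistComul α φ).lTensor H ∘ₗ comulScale α φ)
    (g := comulScale₃ α φ ∘ₗ Coalgebra.comul.lTensor H) (fun κ a ha b hb => ?_) ht
  simp only [LinearMap.comp_apply, comulScale_tmul (hG.isHomogeneous ha) (hG.isHomogeneous hb),
    map_smul, LinearMap.lTensor_tmul, twistComul_apply]
  refine eqOn_balanced (f := phase (φ * ((μ - κ) * (κ - ν))) •
    (TensorProduct.mk ℂ H (H ⊗[ℂ] H) a ∘ₗ comulScale α φ)) (g := comulScale₃ α φ ∘ₗ
      TensorProduct.mk ℂ H (H ⊗[ℂ] H) a) (fun κ' c hc d hd => ?_) (hG.comul_mem hb)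
  simp only [LinearMap.smul_apply, LinearMap.comp_apply, TensorProduct.mk_apply,
    comulScale_tmul (hG.isHomogeneous hc) (hG.isHomogeneous hd), TensorProduct.tmul_smul,
    comulScale₃_tmul (hG.isHomogeneous ha) (hG.isHomogeneous hc) (hG.isHomogeneous hd),
    smul_smul, ← phase_add]
  refine phase_smul_congr ?_ _
  ring

theorem twistComul_coassoc :
    (TensorProduct.assoc ℂ H H H).toLinearMap ∘ₗ (twistComul α φ).rTensor H ∘ₗ twistComul α φ =
      (twistComul α φ).lTensor H ∘ₗ twistComul α φ := by
  refine hG.linearMap_ext fun μ ν x hx => ?_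
  simp only [LinearMap.comp_apply, LinearEquiv.coe_coe, twistComul_apply x]
  rw [hG.rTensor_twistComul φ (hG.comul_mem hx), hG.lTensor_twistComul φ (hG.comul_mem hx),
    Coalgebra.coassoc_apply]

theorem counit_twistComul : (TensorProduct.lid ℂ H).toLinearMap ∘ₗ Coalgebra.counit.rTensor H ∘ₗ
    twistComul α φ = LinearMap.id := by
  refine hG.linearMap_ext fun μ ν x hx => ?_
  have h := eqOn_balanced (f := (TensorProduct.lid ℂ H).toLinearMap ∘ₗ
    Coalgebra.counit.rTensor H ∘ₗ comulScale α φ) (g := (TensorProduct.lid ℂ H).toLinearMap ∘ₗ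
    Coalgebra.counit.rTensor H) (fun κ a ha b hb => ?_) (hG.comul_mem hx)
  · simpa [twistComul_apply] using h
  · simp only [LinearMap.comp_apply, LinearEquiv.coe_coe,
      comulScale_tmul (hG.isHomogeneous ha) (hG.isHomogeneous hb), map_smul,
      LinearMap.rTensor_tmul, TensorProduct.lid_tmul]
    rcases (hG.isHomogeneous ha).eq_or_counit_eq_zero with h | h
    · simp [h, phase_zero]
    · simp [h]

theorem twistComul_counit : (TensorProduct.rid ℂ H).toLinearMap ∘ₗ Coalgebra.counit.lTensor H ∘ₗ
    twistComul α φ = LinearMap.id := by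
  refine hG.linearMap_ext fun μ ν x hx => ?_
  have h := eqOn_balanced (f := (TensorProduct.rid ℂ H).toLinearMap ∘ₗ
    Coalgebra.counit.lTensor H ∘ₗ comulScale α φ) (g := (TensorProduct.rid ℂ H).toLinearMap ∘ₗ
    Coalgebra.counit.lTensor H) (fun κ a ha b hb => ?_) (hG.comul_mem hx)
  · simpa [twistComul_apply] using h
  · simp only [LinearMap.comp_apply, LinearEquiv.coe_coe,
      comulScale_tmul (hG.isHomogeneous ha) (hG.isHomogeneous hb), map_smul,
      LinearMap.lTensor_tmul, TensorProduct.rid_tmul]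
    rcases (hG.isHomogeneous hb).eq_or_counit_eq_zero with h | h
    · simp [h, phase_zero]
    · simp [h]

theorem twistBraiding_neg_comp : twistBraiding α (-φ) ∘ₗ twistBraiding α φ = LinearMap.id := by
  refine hG.linearMap_ext₂ fun μ ν x hx μ' ν' y hy => ?_
  simp only [LinearMap.comp_apply, twistBraiding_tmul (hG.isHomogeneous hx) (hG.isHomogeneous hy),
    map_smul, twistBraiding_tmul (hG.isHomogeneous hy) (hG.isHomogeneous hx), smul_smul,
    ← phase_add, LinearMap.id_apply]
  rw [phase_smul_congr (t := 0) (by ring), phase_zero, one_smul]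

theorem twistBraiding_bijective : Function.Bijective (twistBraiding α φ) := by
  refine Function.bijective_iff_has_inverse.mpr ⟨twistBraiding α (-φ),
    LinearMap.congr_fun (hG.twistBraiding_neg_comp φ), ?_⟩
  have h := hG.twistBraiding_neg_comp (-φ)
  rw [neg_neg] at h
  exact LinearMap.congr_fun h

theorem twistBraiding_braid_equation :
    on23 (twistBraiding α φ) ∘ₗ on12 (twistBraiding α φ) ∘ₗ on23 (twistBraiding α φ) =
      on12 (twistBraiding α φ) ∘ₗ on23 (twistBraiding α φ) ∘ₗ on12 (twistBraiding α φ) := by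
  refine hG.linearMap_ext₃ fun μ ν x hx μ' ν' y hy μ'' ν'' z hz => ?_
  replace hx := hG.isHomogeneous hx
  replace hy := hG.isHomogeneous hy
  replace hz := hG.isHomogeneous hz
  simp only [LinearMap.comp_apply, on23_twistBraiding _ hy hz, on12_twistBraiding hx hz,
    on23_twistBraiding _ hx hy, on12_twistBraiding hx hy, on23_twistBraiding _ hx hz,
    on12_twistBraiding hy hz, map_smul, smul_smul, ← phase_add]
  refine phase_smul_congr ?_ _
  ring

theorem twistBraiding_one_left : twistBraiding α φ ∘ₗ TensorProduct.mk ℂ H H 1 =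
    (TensorProduct.mk ℂ H H).flip 1 := by
  refine hG.linearMap_ext fun μ ν x hx => ?_
  simp [twistBraiding_tmul (hG.isHomogeneous hG.one_mem) (hG.isHomogeneous hx), phase_zero]

theorem twistBraiding_one_right : twistBraiding α φ ∘ₗ (TensorProduct.mk ℂ H H).flip 1 =
    TensorProduct.mk ℂ H H 1 := by
  refine hG.linearMap_ext fun μ ν x hx => ?_
  simp [twistBraiding_tmul (hG.isHomogeneous hx) (hG.isHomogeneous hG.one_mem), phase_zero]

theorem twistBraiding_mul_right : twistBraiding α φ ∘ₗ (twistMul α φ).lTensor H =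
    (twistMul α φ).rTensor H ∘ₗ (TensorProduct.assoc ℂ H H H).symm.toLinearMap ∘ₗ
      on23 (twistBraiding α φ) ∘ₗ on12 (twistBraiding α φ) := by
  refine hG.linearMap_ext₃ fun μ ν x hx μ' ν' y hy μ'' ν'' z hz => ?_
  have hyz := hG.isHomogeneous (hG.mul_mem hy hz)
  replace hx := hG.isHomogeneous hx
  replace hy := hG.isHomogeneous hy
  replace hz := hG.isHomogeneous hz
  simp only [LinearMap.comp_apply, LinearMap.lTensor_tmul, twistMul_tmul hy hz,
    TensorProduct.tmul_smul, map_smul, twistBraiding_tmul hx hyz, on12_twistBraiding hx hy,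
    on23_twistBraiding _ hx hz, LinearEquiv.coe_coe, TensorProduct.assoc_symm_tmul,
    LinearMap.rTensor_tmul, ← TensorProduct.smul_tmul', smul_smul, ← phase_add]
  refine phase_smul_congr ?_ _
  push_cast
  ring

theorem twistBraiding_mul_left : twistBraiding α φ ∘ₗ (twistMul α φ).rTensor H ∘ₗ
      (TensorProduct.assoc ℂ H H H).symm.toLinearMap =
    (twistMul α φ).lTensor H ∘ₗ on12 (twistBraiding α φ) ∘ₗ on23 (twistBraiding α φ) := by
  refine hG.linearMap_ext₃ fun μ ν x hx μ' ν' y hy μ'' ν'' z hz => ?_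
  have hxy := hG.isHomogeneous (hG.mul_mem hx hy)
  replace hx := hG.isHomogeneous hx
  replace hy := hG.isHomogeneous hy
  replace hz := hG.isHomogeneous hz
  simp only [LinearMap.comp_apply, LinearMap.lTensor_tmul, twistMul_tmul hx hy,
    TensorProduct.tmul_smul, map_smul, twistBraiding_tmul hxy hz, on12_twistBraiding hx hz,
    on23_twistBraiding _ hy hz, LinearEquiv.coe_coe, TensorProduct.assoc_symm_tmul,
    LinearMap.rTensor_tmul, ← TensorProduct.smul_tmul', smul_smul, ← phase_add]
  refine phase_smul_congr ?_ _
  push_cast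
  ring

/-- The braiding with a coproduct depends on the outer degrees only, as the `δ` of the two factors
add up. -/
theorem on12_on23_balanced {μ ν μ' ν' : ℤ} {t : H ⊗[ℂ] H} (ht : t ∈ balanced G μ ν) {y : H}
    (hy : y ∈ G μ' ν') :
    on12 (twistBraiding α φ) (on23 (twistBraiding α φ) (TensorProduct.assoc ℂ H H H (t ⊗ₜ y))) =
      phase (2 * φ * ((μ - ν) * (μ' - ν'))) • (y ⊗ₜ[ℂ] t) := by
  refine eqOn_balanced (f := on12 (twistBraiding α φ) ∘ₗ on23 (twistBraiding α φ) ∘ₗ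
    (TensorProduct.assoc ℂ H H H).toLinearMap ∘ₗ (TensorProduct.mk ℂ (H ⊗[ℂ] H) H).flip y)
    (g := phase (2 * φ * ((μ - ν) * (μ' - ν'))) • TensorProduct.mk ℂ H (H ⊗[ℂ] H) y)
    (fun κ a ha b hb => ?_) ht
  simp only [LinearMap.comp_apply, LinearEquiv.coe_coe, LinearMap.flip_apply,
    TensorProduct.mk_apply, TensorProduct.assoc_tmul, LinearMap.smul_apply,
    on23_twistBraiding _ (hG.isHomogeneous hb) (hG.isHomogeneous hy), map_smul,
    on12_twistBraiding (hG.isHomogeneous ha) (hG.isHomogeneous hy), smul_smul, ← phase_add]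
  refine phase_smul_congr ?_ _
  ring

theorem on23_on12_balanced {μ ν μ' ν' : ℤ} {t : H ⊗[ℂ] H} {x : H} (hx : x ∈ G μ ν)
    (ht : t ∈ balanced G μ' ν') :
    on23 (twistBraiding α φ) (on12 (twistBraiding α φ) (x ⊗ₜ t)) =
      phase (2 * φ * ((μ - ν) * (μ' - ν'))) • TensorProduct.assoc ℂ H H H (t ⊗ₜ[ℂ] x) := by
  refine eqOn_balanced (f := on23 (twistBraiding α φ) ∘ₗ on12 (twistBraiding α φ) ∘ₗ
    TensorProduct.mk ℂ H (H ⊗[ℂ] H) x)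
    (g := phase (2 * φ * ((μ - ν) * (μ' - ν'))) • ((TensorProduct.assoc ℂ H H H).toLinearMap ∘ₗ
      (TensorProduct.mk ℂ (H ⊗[ℂ] H) H).flip x)) (fun κ a ha b hb => ?_) ht
  simp only [LinearMap.comp_apply, LinearEquiv.coe_coe, LinearMap.flip_apply,
    TensorProduct.mk_apply, TensorProduct.assoc_tmul, LinearMap.smul_apply,
    on12_twistBraiding (hG.isHomogeneous hx) (hG.isHomogeneous ha), map_smul,
    on23_twistBraiding _ (hG.isHomogeneous hx) (hG.isHomogeneous hb), smul_smul, ← phase_add]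
  refine phase_smul_congr ?_ _
  ring

theorem twistBraiding_comul_left : (twistComul α φ).lTensor H ∘ₗ twistBraiding α φ =
    on12 (twistBraiding α φ) ∘ₗ on23 (twistBraiding α φ) ∘ₗ
      (TensorProduct.assoc ℂ H H H).toLinearMap ∘ₗ (twistComul α φ).rTensor H := by
  refine hG.linearMap_ext₂ fun μ ν x hx μ' ν' y hy => ?_
  simp only [LinearMap.comp_apply, LinearEquiv.coe_coe, LinearMap.rTensor_tmul,
    twistBraiding_tmul (hG.isHomogeneous hx) (hG.isHomogeneous hy), map_smul,
    LinearMap.lTensor_tmul, hG.on12_on23_balanced φ (hG.twistComul_mem φ hx) hy]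

theorem twistBraiding_comul_right : (TensorProduct.assoc ℂ H H H).toLinearMap ∘ₗ
      (twistComul α φ).rTensor H ∘ₗ twistBraiding α φ =
    on23 (twistBraiding α φ) ∘ₗ on12 (twistBraiding α φ) ∘ₗ (twistComul α φ).lTensor H := by
  refine hG.linearMap_ext₂ fun μ ν x hx μ' ν' y hy => ?_
  simp only [LinearMap.comp_apply, LinearEquiv.coe_coe, LinearMap.lTensor_tmul,
    twistBraiding_tmul (hG.isHomogeneous hx) (hG.isHomogeneous hy), map_smul,
    LinearMap.rTensor_tmul, hG.on23_on12_balanced φ hx (hG.twistComul_mem φ hy)]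

theorem twistBraiding_counit_left : (TensorProduct.rid ℂ H).toLinearMap ∘ₗ
    Coalgebra.counit.lTensor H ∘ₗ twistBraiding α φ =
      (TensorProduct.lid ℂ H).toLinearMap ∘ₗ Coalgebra.counit.rTensor H := by
  refine hG.linearMap_ext₂ fun μ ν x hx μ' ν' y hy => ?_
  simp only [LinearMap.comp_apply, LinearEquiv.coe_coe, LinearMap.lTensor_tmul,
    twistBraiding_tmul (hG.isHomogeneous hx) (hG.isHomogeneous hy), map_smul,
    LinearMap.rTensor_tmul, TensorProduct.rid_tmul, TensorProduct.lid_tmul]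
  rcases (hG.isHomogeneous hx).eq_or_counit_eq_zero with h | h
  · simp [h, phase_zero]
  · simp [h]

theorem twistBraiding_counit_right : (TensorProduct.lid ℂ H).toLinearMap ∘ₗ
    Coalgebra.counit.rTensor H ∘ₗ twistBraiding α φ =
      (TensorProduct.rid ℂ H).toLinearMap ∘ₗ Coalgebra.counit.lTensor H := by
  refine hG.linearMap_ext₂ fun μ ν x hx μ' ν' y hy => ?_
  simp only [LinearMap.comp_apply, LinearEquiv.coe_coe, LinearMap.lTensor_tmul,
    twistBraiding_tmul (hG.isHomogeneous hx) (hG.isHomogeneous hy), map_smul,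
    LinearMap.rTensor_tmul, TensorProduct.rid_tmul, TensorProduct.lid_tmul]
  rcases (hG.isHomogeneous hy).eq_or_counit_eq_zero with h | h
  · simp [h, phase_zero]
  · simp [h]

theorem twistBraiding_antipode_left : twistBraiding α φ ∘ₗ (twistAntipode α φ).rTensor H =
    (twistAntipode α φ).lTensor H ∘ₗ twistBraiding α φ := by
  refine hG.linearMap_ext₂ fun μ ν x hx μ' ν' y hy => ?_
  simp only [LinearMap.comp_apply, LinearMap.lTensor_tmul, LinearMap.rTensor_tmul,
    twistBraiding_tmul (hG.isHomogeneous hx) (hG.isHomogeneous hy), map_smul,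
    twistAntipode_apply (hG.isHomogeneous hx), ← TensorProduct.smul_tmul',
    twistBraiding_tmul (hG.isHomogeneous (hG.antipode_mem hx)) (hG.isHomogeneous hy),
    TensorProduct.tmul_smul, smul_smul, ← phase_add]
  refine phase_smul_congr ?_ _
  push_cast
  ring

theorem twistBraiding_antipode_right : twistBraiding α φ ∘ₗ (twistAntipode α φ).lTensor H =
    (twistAntipode α φ).rTensor H ∘ₗ twistBraiding α φ := by
  refine hG.linearMap_ext₂ fun μ ν x hx μ' ν' y hy => ?_
  simp only [LinearMap.comp_apply, LinearMap.lTensor_tmul, LinearMap.rTensor_tmul,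
    twistBraiding_tmul (hG.isHomogeneous hx) (hG.isHomogeneous hy), map_smul,
    twistAntipode_apply (hG.isHomogeneous hy), ← TensorProduct.smul_tmul',
    twistBraiding_tmul (hG.isHomogeneous hx) (hG.isHomogeneous (hG.antipode_mem hy)),
    TensorProduct.tmul_smul, smul_smul, ← phase_add]
  refine phase_smul_congr ?_ _
  push_cast
  ring

theorem twistComul_one : twistComul α φ 1 = 1 ⊗ₜ[ℂ] (1 : H) := by
  rw [twistComul_apply, Bialgebra.comul_one, Algebra.TensorProduct.one_def,
    comulScale_tmul (hG.isHomogeneous hG.one_mem) (hG.isHomogeneous hG.one_mem)]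
  simp [phase_zero]

/-- The multiplicativity of the twisted coproduct, for arbitrary elements in the place of the two
coproducts. It is an identity between quadratic polynomials in the six degrees involved. -/
theorem comulScale_mul {μ ν μ' ν' : ℤ} {t s : H ⊗[ℂ] H} (ht : t ∈ balanced G μ ν)
    (hs : s ∈ balanced G μ' ν') :
    phase (φ * (μ * ν' - ν * μ')) • comulScale α φ (t * s) =
      TensorProduct.map (twistMul α φ) (twistMul α φ) (onMiddle (twistBraiding α φ)
        (comulScale α φ t ⊗ₜ comulScale α φ s)) := by
  refine eqOn_balanced (f := phase (φ * (μ * ν' - ν * μ')) •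
    (comulScale α φ ∘ₗ LinearMap.mulRight ℂ s)) (g := TensorProduct.map (twistMul α φ)
      (twistMul α φ) ∘ₗ onMiddle (twistBraiding α φ) ∘ₗ
      (TensorProduct.mk ℂ (H ⊗[ℂ] H) (H ⊗[ℂ] H)).flip (comulScale α φ s) ∘ₗ comulScale α φ)
    (fun κ a ha b hb => ?_) ht
  refine eqOn_balanced (f := phase (φ * (μ * ν' - ν * μ')) •
    (comulScale α φ ∘ₗ LinearMap.mulLeft ℂ (a ⊗ₜ b))) (g := TensorProduct.map (twistMul α φ)
      (twistMul α φ) ∘ₗ onMiddle (twistBraiding α φ) ∘ₗ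
      TensorProduct.mk ℂ (H ⊗[ℂ] H) (H ⊗[ℂ] H) (comulScale α φ (a ⊗ₜ b)) ∘ₗ comulScale α φ)
    (fun κ' c hc d hd => ?_) hs
  have hac := hG.isHomogeneous (hG.mul_mem ha hc)
  have hbd := hG.isHomogeneous (hG.mul_mem hb hd)
  replace ha := hG.isHomogeneous ha
  replace hb := hG.isHomogeneous hb
  replace hc := hG.isHomogeneous hc
  replace hd := hG.isHomogeneous hd
  simp only [LinearMap.smul_apply, LinearMap.comp_apply, LinearMap.mulLeft_apply,
    Algebra.TensorProduct.tmul_mul_tmul, comulScale_tmul hac hbd, TensorProduct.mk_apply,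
    comulScale_tmul ha hb, comulScale_tmul hc hd, ← TensorProduct.smul_tmul',
    TensorProduct.tmul_smul, map_smul, onMiddle_twistBraiding _ _ hb hc, TensorProduct.map_tmul,
    twistMul_tmul ha hc, twistMul_tmul hb hd, smul_smul, ← phase_add]
  refine phase_smul_congr ?_ _
  push_cast
  ring

theorem twistComul_mul : twistComul α φ ∘ₗ twistMul α φ =
    TensorProduct.map (twistMul α φ) (twistMul α φ) ∘ₗ onMiddle (twistBraiding α φ) ∘ₗ
      TensorProduct.map (twistComul α φ) (twistComul α φ) := by
  refine hG.linearMap_ext₂ fun μ ν x hx μ' ν' y hy => ?_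
  simp only [LinearMap.comp_apply, twistMul_tmul (hG.isHomogeneous hx) (hG.isHomogeneous hy),
    map_smul, twistComul_apply, TensorProduct.map_tmul, Bialgebra.comul_mul]
  exact hG.comulScale_mul φ (hG.comul_mem hx) (hG.comul_mem hy)

theorem counit_twistMul : Coalgebra.counit ∘ₗ twistMul α φ =
    LinearMap.mul' ℂ ℂ ∘ₗ TensorProduct.map (Coalgebra.counit (R := ℂ) (A := H))
      Coalgebra.counit := by
  refine hG.linearMap_ext₂ fun μ ν x hx μ' ν' y hy => ?_
  simp only [LinearMap.comp_apply, twistMul_tmul (hG.isHomogeneous hx) (hG.isHomogeneous hy),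
    map_smul, TensorProduct.map_tmul, LinearMap.mul'_apply, Bialgebra.counit_mul]
  rcases (hG.isHomogeneous hx).eq_or_counit_eq_zero with h | h
  · rcases (hG.isHomogeneous hy).eq_or_counit_eq_zero with h' | h'
    · simp [h, h', phase_zero]
    · simp [h']
  · simp [h]

/-- The phases of the coproduct, the antipode and the product combine to a factor which depends
on the degrees of `x` only, and is `1` unless the counit of `x` vanishes. -/
theorem twistAntipode_left : twistMul α φ ∘ₗ (twistAntipode α φ).rTensor H ∘ₗ twistComul α φ =
    Algebra.linearMap ℂ H ∘ₗ Coalgebra.counit := by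
  refine hG.linearMap_ext fun μ ν x hx => ?_
  have h := eqOn_balanced (f := twistMul α φ ∘ₗ (twistAntipode α φ).rTensor H ∘ₗ comulScale α φ)
    (g := phase (φ * (μ * (μ - ν))) •
      (LinearMap.mul' ℂ H ∘ₗ (HopfAlgebra.antipode ℂ).rTensor H)) (fun κ a ha b hb => ?_)
    (hG.comul_mem hx)
  · simp only [LinearMap.comp_apply, LinearMap.smul_apply,
      HopfAlgebra.mul_antipode_rTensor_comul_apply] at h
    simp only [LinearMap.comp_apply, twistComul_apply, h, Algebra.linearMap_apply]
    rcases (hG.isHomogeneous hx).eq_or_counit_eq_zero with h | h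
    · simp [h, phase_zero]
    · simp [h]
  · have ha' := hG.isHomogeneous (hG.antipode_mem ha)
    replace ha := hG.isHomogeneous ha
    replace hb := hG.isHomogeneous hb
    simp only [LinearMap.comp_apply, LinearMap.smul_apply, comulScale_tmul ha hb, map_smul,
      LinearMap.rTensor_tmul, twistAntipode_apply ha, ← TensorProduct.smul_tmul',
      twistMul_tmul ha' hb, LinearMap.mul'_apply, smul_smul, ← phase_add]
    refine phase_smul_congr ?_ _
    push_cast
    ring

/-- As for `twistAntipode_left`, with the remaining exponent `-ν (μ - ν)` in place of
`μ (μ - ν)`. -/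
theorem twistAntipode_right : twistMul α φ ∘ₗ (twistAntipode α φ).lTensor H ∘ₗ twistComul α φ =
    Algebra.linearMap ℂ H ∘ₗ Coalgebra.counit := by
  refine hG.linearMap_ext fun μ ν x hx => ?_
  have h := eqOn_balanced (f := twistMul α φ ∘ₗ (twistAntipode α φ).lTensor H ∘ₗ comulScale α φ)
    (g := phase (φ * (-ν * (μ - ν))) •
      (LinearMap.mul' ℂ H ∘ₗ (HopfAlgebra.antipode ℂ).lTensor H)) (fun κ a ha b hb => ?_)
    (hG.comul_mem hx)
  · simp only [LinearMap.comp_apply, LinearMap.smul_apply,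
      HopfAlgebra.mul_antipode_lTensor_comul_apply] at h
    simp only [LinearMap.comp_apply, twistComul_apply, h, Algebra.linearMap_apply]
    rcases (hG.isHomogeneous hx).eq_or_counit_eq_zero with h | h
    · simp [h, phase_zero]
    · simp [h]
  · have hb' := hG.isHomogeneous (hG.antipode_mem hb)
    replace ha := hG.isHomogeneous ha
    replace hb := hG.isHomogeneous hb
    simp only [LinearMap.comp_apply, LinearMap.smul_apply, comulScale_tmul ha hb, map_smul,
      LinearMap.lTensor_tmul, twistAntipode_apply hb, TensorProduct.tmul_smul,
      twistMul_tmul ha hb', LinearMap.mul'_apply, smul_smul, ← phase_add]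
    refine phase_smul_congr ?_ _
    push_cast
    ring

theorem isBraidedHopfAlgebra : IsBraidedHopfAlgebra (twistMul α φ) 1 (twistComul α φ)
    Coalgebra.counit (twistAntipode α φ) (twistBraiding α φ) where
  mul_assoc x y z := LinearMap.congr_fun (hG.twistMul_assoc φ) (x ⊗ₜ (y ⊗ₜ z))
  one_mul := LinearMap.congr_fun (hG.twistMul_one_left φ)
  mul_one := LinearMap.congr_fun (hG.twistMul_one_right φ)
  coassoc := hG.twistComul_coassoc φ
  counit_comul := LinearMap.congr_fun (hG.counit_twistComul φ)
  comul_counit := LinearMap.congr_fun (hG.twistComul_counit φ)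
  braiding_bijective := hG.twistBraiding_bijective φ
  braid_equation := hG.twistBraiding_braid_equation φ
  braiding_one_left := LinearMap.congr_fun (hG.twistBraiding_one_left φ)
  braiding_one_right := LinearMap.congr_fun (hG.twistBraiding_one_right φ)
  braiding_mul_right := hG.twistBraiding_mul_right φ
  braiding_mul_left := hG.twistBraiding_mul_left φ
  braiding_comul_left := hG.twistBraiding_comul_left φ
  braiding_comul_right := hG.twistBraiding_comul_right φ
  braiding_counit_left x y := LinearMap.congr_fun (hG.twistBraiding_counit_left φ) (x ⊗ₜ y)
  braiding_counit_right x y := LinearMap.congr_fun (hG.twistBraiding_counit_right φ) (x ⊗ₜ y)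
  braiding_antipode_left := hG.twistBraiding_antipode_left φ
  braiding_antipode_right := hG.twistBraiding_antipode_right φ
  comul_one := hG.twistComul_one φ
  comul_mul := hG.twistComul_mul φ
  counit_one := Bialgebra.counit_one
  counit_mul x y := LinearMap.congr_fun (hG.counit_twistMul φ) (x ⊗ₜ y)
  antipode_left x := by
    rw [← Algebra.algebraMap_eq_smul_one]
    exact LinearMap.congr_fun (hG.twistAntipode_left φ) x
  antipode_right x := by
    rw [← Algebra.algebraMap_eq_smul_one]
    exact LinearMap.congr_fun (hG.twistAntipode_right φ) x

end IsBigrading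

end HopfTwist

namespace SUq

open QMatrix HopfTwist

/-! ### The bigrading by monomials -/

variable {n : ℕ} {q : ℝ}

/-- The monomial in the generators with the given list of indices. -/
def monomial (q : ℝ) (w : List (Fin n × Fin n)) : SUq n q := (w.map fun d => u n q d.1 d.2).prod

theorem monomial_append (w w' : List (Fin n × Fin n)) :
    monomial q (w ++ w') = monomial q w * monomial q w' := by
  simp [monomial]

theorem span_monomial : Submodule.span ℂ (Set.range (monomial (n := n) q)) = ⊤ := by
  refine eq_top_iff.mpr fun x _ => ?_
  induction x using induction with
  | algebraMap c =>
    rw [Algebra.algebraMap_eq_smul_one]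
    exact Submodule.smul_mem _ _ (Submodule.subset_span ⟨[], rfl⟩)
  | u i j => exact Submodule.subset_span ⟨[(i, j)], by simp [monomial]⟩
  | add x y hx hy => exact Submodule.add_mem _ (hx trivial) (hy trivial)
  | mul x y hx hy =>
    have h := Submodule.mul_mem_mul (hx trivial) (hy trivial)
    rw [Submodule.span_mul_span] at h
    refine Submodule.span_mono ?_ h
    rintro _ ⟨_, ⟨w, rfl⟩, _, ⟨w', rfl⟩, rfl⟩
    exact ⟨w ++ w', monomial_append w w'⟩

variable (p : Fin n → ℤ)

variable (q) in
/-- The span of the monomials `u i₁ j₁ ⋯ u iᵣ jᵣ` with `∑ p iₛ = μ` and `∑ p jₛ = ν`. -/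
def bidegree (μ ν : ℤ) : Submodule ℂ (SUq n q) :=
  Submodule.span ℂ (monomial q ''
    {w | (w.map fun d => p d.1).sum = μ ∧ (w.map fun d => p d.2).sum = ν})

theorem monomial_mem_bidegree (w : List (Fin n × Fin n)) :
    monomial q w ∈ bidegree q p (w.map fun d => p d.1).sum (w.map fun d => p d.2).sum :=
  Submodule.subset_span ⟨w, ⟨rfl, rfl⟩, rfl⟩

theorem one_mem_bidegree : (1 : SUq n q) ∈ bidegree q p 0 0 :=
  monomial_mem_bidegree p []

theorem u_mem_bidegree (i j : Fin n) : u n q i j ∈ bidegree q p (p i) (p j) := by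
  simpa [monomial] using monomial_mem_bidegree (q := q) p [(i, j)]

variable {p}

theorem mul_mem_bidegree {μ ν μ' ν' : ℤ} {x y : SUq n q} (hx : x ∈ bidegree q p μ ν)
    (hy : y ∈ bidegree q p μ' ν') : x * y ∈ bidegree q p (μ + μ') (ν + ν') := by
  have h := Submodule.mul_mem_mul hx hy
  rw [bidegree, bidegree, Submodule.span_mul_span] at h
  refine Submodule.span_mono ?_ h
  rintro _ ⟨_, ⟨w, ⟨rfl, rfl⟩, rfl⟩, _, ⟨w', ⟨rfl, rfl⟩, rfl⟩, rfl⟩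
  exact ⟨w ++ w', by simp, monomial_append w w'⟩

theorem mul_mem_balanced {μ ν μ' ν' : ℤ} {t s : SUq n q ⊗[ℂ] SUq n q}
    (ht : t ∈ balanced (bidegree q p) μ ν) (hs : s ∈ balanced (bidegree q p) μ' ν') :
    t * s ∈ balanced (bidegree q p) (μ + μ') (ν + ν') := by
  have h := Submodule.mul_mem_mul ht hs
  rw [balanced, balanced, Submodule.span_mul_span] at h
  refine Submodule.span_mono ?_ h
  rintro _ ⟨_, ⟨κ, a, ha, b, hb, rfl⟩, _, ⟨κ', c, hc, d, hd, rfl⟩, rfl⟩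
  exact ⟨κ + κ', a * c, mul_mem_bidegree ha hc, b * d, mul_mem_bidegree hb hd,
    (Algebra.TensorProduct.tmul_mul_tmul a c b d).symm⟩

theorem bidegree_le {μ ν : ℤ} {K : Submodule ℂ (SUq n q)} (h : ∀ w : List (Fin n × Fin n),
    (w.map fun d => p d.1).sum = μ → (w.map fun d => p d.2).sum = ν → monomial q w ∈ K) :
    bidegree q p μ ν ≤ K := by
  refine Submodule.span_le.mpr ?_
  rintro _ ⟨w, ⟨h1, h2⟩, rfl⟩
  exact h w h1 h2

section

variable [NeZero q]

theorem comul_monomial_mem (w : List (Fin n × Fin n)) : comulHom n q (monomial q w) ∈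
    balanced (bidegree q p) (w.map fun d => p d.1).sum (w.map fun d => p d.2).sum := by
  induction w with
  | nil =>
    simp only [monomial, List.map_nil, List.prod_nil, List.sum_nil, map_one]
    exact Submodule.subset_span ⟨0, 1, one_mem_bidegree p, 1, one_mem_bidegree p, rfl⟩
  | cons d w ih =>
    have h : monomial q (d :: w) = u n q d.1 d.2 * monomial q w := by simp [monomial]
    rw [h, map_mul, List.map_cons, List.sum_cons, List.map_cons, List.sum_cons]
    refine mul_mem_balanced ?_ ih
    rw [comulHom_u]
    exact Submodule.sum_mem _ fun k _ => Submodule.subset_span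
      ⟨p k, _, u_mem_bidegree p _ _, _, u_mem_bidegree p _ _, rfl⟩

end

variable (hp : ∑ k, p k = 0)
include hp

/-- The cofactors are homogeneous: as the `p k` sum to zero, the sum over all `k` except `i`
is `-p i`. -/
theorem cof_mem_bidegree (i j : Fin n) :
    cof (q : ℂ) (u n q) i j ∈ bidegree q p (-p i) (-p j) := by
  rcases n with _ | n
  · exact i.elim0
  have h : ∀ i, ∑ k : Fin n, p (i.succAbove k) = -p i := fun i => by
    rw [Fin.sum_univ_succAbove p i] at hp
    omega
  refine Submodule.smul_mem _ _ (Submodule.sum_mem _ fun σ _ => Submodule.smul_mem _ _ ?_)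
  have h1 := monomial_mem_bidegree (q := q) p
    (List.ofFn fun k => (i.succAbove k, j.succAbove (σ k)))
  have h2 := Equiv.sum_comp σ fun k => p (j.succAbove k)
  simpa only [monomial, List.map_ofFn, Function.comp_def, List.sum_ofFn, h2, h] using h1

variable [NeZero q]

theorem antipode_monomial_mem (w : List (Fin n × Fin n)) : antipodeLin n q (monomial q w) ∈
    bidegree q p (-(w.map fun d => p d.2).sum) (-(w.map fun d => p d.1).sum) := by
  induction w with
  | nil =>
    simp only [monomial, List.map_nil, List.prod_nil, List.sum_nil, neg_zero, antipodeLin_one]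
    exact one_mem_bidegree p
  | cons d w ih =>
    have h : monomial q (d :: w) = u n q d.1 d.2 * monomial q w := by simp [monomial]
    rw [h, antipodeLin_mul, List.map_cons, List.sum_cons, List.map_cons, List.sum_cons, neg_add_rev,
      neg_add_rev, antipodeLin_u]
    exact mul_mem_bidegree ih (cof_mem_bidegree hp _ _)

theorem isHomogeneous_u (i j : Fin n) :
    IsHomogeneous (torusHom q p hp) (p i) (p j) (u n q i j) := by
  have h : ∀ i j, (torusHom q p hp : SUq n q →ₗ[ℂ] ℂ[T;T⁻¹]) (u n q i j) =
      if i = j then LaurentPolynomial.T (p i) else 0 := torusHom_u p hp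
  constructor
  · simp [leftCoaction, comul_eq, comulHom_u, h, TensorProduct.ite_tmul]
  · simp [rightCoaction, comul_eq, comulHom_u, h, TensorProduct.tmul_ite]

theorem isHomogeneous_monomial (w : List (Fin n × Fin n)) : IsHomogeneous (torusHom q p hp)
    (w.map fun d => p d.1).sum (w.map fun d => p d.2).sum (monomial q w) := by
  induction w with
  | nil => exact IsHomogeneous.one _
  | cons d w ih =>
    have h : monomial q (d :: w) = u n q d.1 d.2 * monomial q w := by simp [monomial]
    rw [h, List.map_cons, List.sum_cons, List.map_cons, List.sum_cons]
    exact (isHomogeneous_u hp d.1 d.2).mul ih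

theorem isBigrading : IsBigrading (torusHom q p hp) (bidegree q p) where
  isHomogeneous {μ ν x} hx := by
    suffices bidegree q p μ ν ≤ homogeneousSubmodule (torusHom q p hp) μ ν from this hx
    refine bidegree_le ?_
    rintro w rfl rfl
    exact isHomogeneous_monomial hp w
  one_mem := one_mem_bidegree p
  mul_mem := mul_mem_bidegree
  comul_mem {μ ν x} hx := by
    suffices bidegree q p μ ν ≤ (balanced (bidegree q p) μ ν).comap Coalgebra.comul from this hx
    refine bidegree_le ?_
    rintro w rfl rfl
    exact comul_monomial_mem w
  antipode_mem {μ ν x} hx := by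
    suffices bidegree q p μ ν ≤ (bidegree q p (-ν) (-μ)).comap (HopfAlgebra.antipode ℂ) from this hx
    refine bidegree_le ?_
    rintro w rfl rfl
    exact antipode_monomial_mem hp w
  iSup_eq_top := by
    have key : ∀ μ ν, bidegree q p μ ν ≤ ⨆ d : ℤ × ℤ, bidegree q p d.1 d.2 := fun μ ν =>
      le_iSup (fun d : ℤ × ℤ => bidegree q p d.1 d.2) (μ, ν)
    refine eq_top_iff.mpr (span_monomial.ge.trans (Submodule.span_le.mpr ?_))
    rintro _ ⟨w, rfl⟩
    exact key _ _ (monomial_mem_bidegree p w)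

/-- There are countably many monomials, so that a basis can be selected among them. -/
theorem exists_countable_homogeneous_basis : ∃ b : Set (SUq n q), b.Countable ∧
    LinearIndepOn ℂ id b ∧ Submodule.span ℂ b = ⊤ ∧
    ∀ x ∈ b, ∃ μ ν : ℤ, IsHomogeneous (torusHom q p hp) μ ν x := by
  obtain ⟨b, hb, hspan, hli⟩ := exists_linearIndependent ℂ (Set.range (monomial (n := n) q))
  refine ⟨b, (Set.countable_range _).mono hb, hli, hspan.trans span_monomial, fun x hx => ?_⟩
  obtain ⟨w, rfl⟩ := hb hx
  exact ⟨_, _, isHomogeneous_monomial hp w⟩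

/-! ### The structure maps on the generators -/

variable (φ : ℝ)

theorem isBraidedHopfAlgebra_twist : IsBraidedHopfAlgebra (twistMul (torusHom q p hp) φ) 1
    (twistComul (torusHom q p hp) φ) Coalgebra.counit (twistAntipode (torusHom q p hp) φ)
    (twistBraiding (torusHom q p hp) φ) :=
  (isBigrading hp).isBraidedHopfAlgebra φ

theorem twistMul_u (i j k l : Fin n) : twistMul (torusHom q p hp) φ (u n q i j ⊗ₜ u n q k l) =
    Complex.exp (Complex.I * φ * (p i * p l - p k * p j)) • (u n q i j * u n q k l) := by
  rw [twistMul_tmul (isHomogeneous_u hp i j) (isHomogeneous_u hp k l), phase]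
  congr 2
  push_cast
  ring

theorem twistComul_u (i j : Fin n) : twistComul (torusHom q p hp) φ (u n q i j) =
    ∑ k, Complex.exp (Complex.I * φ * ((p i - p k) * (p k - p j))) •
      (u n q i k ⊗ₜ[ℂ] u n q k j) := by
  rw [twistComul_apply, comul_eq, comulHom_u, map_sum]
  refine Finset.sum_congr rfl fun k _ => ?_
  rw [comulScale_tmul (isHomogeneous_u hp i k) (isHomogeneous_u hp k j), phase]
  congr 2
  push_cast
  ring

theorem twistBraiding_u (i j k l : Fin n) :
    twistBraiding (torusHom q p hp) φ (u n q i j ⊗ₜ u n q k l) =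
      Complex.exp (2 * Complex.I * φ * ((p i - p j) * (p k - p l))) •
        (u n q k l ⊗ₜ[ℂ] u n q i j) := by
  rw [twistBraiding_tmul (isHomogeneous_u hp i j) (isHomogeneous_u hp k l), phase]
  congr 2
  push_cast
  ring

theorem twistAntipode_u (i j : Fin n) : twistAntipode (torusHom q p hp) φ (u n q i j) =
    Complex.exp (Complex.I * φ * (p i - p j) ^ 2) • HopfAlgebra.antipode ℂ (u n q i j) := by
  rw [twistAntipode_apply (isHomogeneous_u hp i j), phase]
  congr 2
  push_cast
  ring

end SUq

end

theorem mainTheorem6 (n : ℕ) (q : ℝ) (hq : q ≠ 0) (p : Fin n → ℤ) (hp : ∑ k, p k = 0) (φ : ℝ) :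
    ∃ (_ : HopfAlgebra ℂ (SUq n q)) (_ : StarRing (SUq n q)) (_ : StarModule ℂ (SUq n q)),
      SUq.IsStandardHopfStar n q ∧
      ∃ α : SUq n q →ₐc[ℂ] ℂ[T;T⁻¹],
        -- the map `u_{ij} ↦ z^{p(i)} δ_{ij}` is a morphism of Hopf `∗`-algebras
        (∀ i j, α (SUq.u n q i j) = if i = j then LaurentPolynomial.T (p i) else 0) ∧
        (∀ x, α (HopfAlgebra.antipode ℂ x) = HopfAlgebra.antipode ℂ (α x)) ∧
        (∀ x, α (star x) = HopfTwist.laurentStar (α x)) ∧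
        -- there is a countable basis of homogeneous elements, and `u_{ij}` has degrees `p(i), p(j)`
        (∃ b : Set (SUq n q), b.Countable ∧ LinearIndepOn ℂ id b ∧ Submodule.span ℂ b = ⊤ ∧
          ∀ x ∈ b, ∃ μ ν : ℤ, HopfTwist.IsHomogeneous α μ ν x) ∧
        (∀ i j, HopfTwist.IsHomogeneous α (p i) (p j) (SUq.u n q i j)) ∧
        -- the twist is a braided Hopf algebra with the same unit and counit
        IsBraidedHopfAlgebra (HopfTwist.twistMul α φ) 1 (HopfTwist.twistComul α φ)
          Coalgebra.counit (HopfTwist.twistAntipode α φ) (HopfTwist.twistBraiding α φ) ∧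
        -- the structure maps on generators
        (∀ i j k l, HopfTwist.twistMul α φ (SUq.u n q i j ⊗ₜ SUq.u n q k l) =
          Complex.exp (Complex.I * φ * (p i * p l - p k * p j)) •
            (SUq.u n q i j * SUq.u n q k l)) ∧
        (∀ i j, HopfTwist.twistComul α φ (SUq.u n q i j) =
          ∑ k, Complex.exp (Complex.I * φ * ((p i - p k) * (p k - p j))) •
            (SUq.u n q i k ⊗ₜ[ℂ] SUq.u n q k j)) ∧
        (∀ i j k l, HopfTwist.twistBraiding α φ (SUq.u n q i j ⊗ₜ SUq.u n q k l) =
          Complex.exp (2 * Complex.I * φ * ((p i - p j) * (p k - p l))) •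
            (SUq.u n q k l ⊗ₜ[ℂ] SUq.u n q i j)) ∧
        (∀ i j, HopfTwist.twistAntipode α φ (SUq.u n q i j) =
          Complex.exp (Complex.I * φ * (p i - p j) ^ 2) •
            HopfAlgebra.antipode ℂ (SUq.u n q i j)) := by
  have : NeZero q := ⟨hq⟩
  exact ⟨SUq.instHopfAlgebra n q, SUq.instStarRing, SUq.instStarModule, SUq.isStandardHopfStar,
    SUq.torusHom q p hp, SUq.torusHom_u p hp, SUq.torusHom_antipode p hp, SUq.torusHom_star p hp,
    SUq.exists_countable_homogeneous_basis hp, SUq.isHomogeneous_u hp,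
    SUq.isBraidedHopfAlgebra_twist hp φ, SUq.twistMul_u hp φ, SUq.twistComul_u hp φ,
    SUq.twistBraiding_u hp φ, SUq.twistAntipode_u hp φ⟩
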